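/- Notation. Let $\Delta>0$, $B_\Delta=\{z\in\mathbb C: |\operatorname{Im} z|<\Delta\}$. Let $g:\mathbb R\to\mathbb R$ be the lift of an analytic orientation preserving circle diffeomorphism, $g(x+1)=g(x)+1$, that extends to a holomorphic diffeomorphism (again denoted $g$) between two open subsets of $\mathbb C$ each of which contains $\overline{B_\Delta}$. Assume that the rotation number $\alpha$ of $g$ is irrational and that $$\|D\log Dg\|_{C^0(B_\Delta)}=\sup_{B_\Delta}\left|\frac{g''}{g'}\right|<\frac19 .$$ Let $(p_n/q_n)_{n\ge 0}$ be the convergents of $\alpha$ and $m_n(x)=g^{q_n}(x)-x-p_n$ for $x\in\mathbb R$. Let $d_P$ be the Poincaré distance of the upper half plane $\mathbb H$ (metric $|dz|/\operatorname{Im} z$), $\mathcal D_P$ the associated Hausdorff distance, and $B_P(c,r)$ the open $d_P$-ball of centre $c$ and radius $r$. If $h$ is an increasing homeomorphism of $\mathbb R$ with $h(x+1)=h(x)+1$ and $h^{-1}\circ g\circ h(x)=x+\alpha$, let $\varphi_t(x)=h(h^{-1}(x)+t\alpha)$, and for $z_0=x_0+i\,|m_n(x_0)|\,y_0$ let $\Phi^{(n)}_{z_0}=\{\varphi_t(x_0)+i\,|m_n(\varphi_t(x_0))|\,y_0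 : t\in\mathbb R\}$. The iterates $g^j$, $j\in\mathbb Z$, are partially defined maps on $\mathbb C$: $g^j$ is defined at $z$ when the successive images of $z$ under $g$ (under $g^{-1}$ if $j<0$) can be formed. A curve $\gamma\subset\mathbb H$ is called quasi-invariant (at level $n$, with constant $C$) if it is the graph $\{x+i\eta(x)\}$ of a continuous, positive, $1$-periodic function $\eta$; the iterates $g^j$, $0\le j\le q_n$, are all defined in a neighbourhood of $\{0\le\operatorname{Im}z\le\eta(\operatorname{Re}z)\}$; $\mathcal D_P(g^j(\gamma),\gamma)\le C$ for $0\le j\le q_n$; and $d_P(g^{q_n}(z)-p_n,z)\le C$ for all $z\in\gamma$. Theorem (Osculating orbit). There is a universal constant $C_0>0$ such that, for all $\Delta$ and $g$ as above, a homeomorphism $h$ as above exists and the following holds. For every $H>0$ there is $n_0\ge 1$ such that for every $n\ge n_0$ there is a point $z_0=x_0+i\,|m_{n-1}(x_0)|\,y_0$ with $\tfrac12<y_0<1$ such that: 1. $\gamma_n=\Phi^{(n-1)}_{z_0}$ is a quasi-invariant curve (at level $n$, with constant $C_0$), and $g^j(z_0)$ is defined for $0\le j\le q_n$; 2. the set $$U_n=\bigcup_{0\le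 j<q_n,\ k\in\mathbb Z}B_P(g^j(z_0)+k,C_0)$$ separates $\mathbb R$ from $\{\operatorname{Im}z>H\}$, that is, it is disjoint from both sets and no connected component of $\mathbb C\setminus U_n$ meets both; 3. if $\operatorname{Im}w_0>H$ and some iterate $g^i(w_0)$, $i\in\mathbb Z$, lies strictly between $\mathbb R$ and $\gamma_n$, then for every $0\le j\le q_n$ some iterate $g^i(w_0)$, $i\in\mathbb Z$, lies in $\bigcup_{k\in\mathbb Z}B_P(g^j(z_0)+k,C_0)$. -/

import Mathlib

open Set Complex

namespace CircleDyn

noncomputable section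

/-- The open horizontal strip `|Im z| < Δ`. -/
def strip (Δ : ℝ) : Set ℂ := {z | |z.im| < Δ}

/-- The lift `g : ℝ → ℝ` of a circle map belongs to `D^ω(𝕋, Δ)`, with holomorphic extension `G`:
a holomorphic diffeomorphism between two open sets of `ℂ`, each of which contains the closed strip
`|Im z| ≤ Δ`, that agrees with `g` on the real line. -/
structure IsAnalyticDiffeo (Δ : ℝ) (g : CircleDeg1Lift) (G : OpenPartialHomeomorph ℂ ℂ) :
    Prop where
  holo : DifferentiableOn ℂ G G.source
  strip_source : closure (strip Δ) ⊆ G.source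
  strip_target : closure (strip Δ) ⊆ G.target
  real : ∀ x : ℝ, G (x : ℂ) = (g x : ℂ)

/-- Forward iterates of a partially defined homeomorphism; a point is in the source of the `n`-th
iterate iff its first `n` iterates can be formed. -/
def iter (G : OpenPartialHomeomorph ℂ ℂ) : ℕ → OpenPartialHomeomorph ℂ ℂ
  | 0 => OpenPartialHomeomorph.refl ℂ
  | n + 1 => (iter G n).trans G

/-- Iterates of a partially defined homeomorphism with exponent in `ℤ`. -/
def ziter (G : OpenPartialHomeomorph ℂ ℂ) : ℤ → OpenPartialHomeomorph ℂ ℂ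
  | Int.ofNat n => iter G n
  | Int.negSucc n => (iter G (n + 1)).symm

/-- The rotation number of (the lift) `g`. -/
def rot (g : CircleDeg1Lift) : ℝ := CircleDeg1Lift.translationNumber g

/-- The numerator `p_n` of the `n`-th convergent of the rotation number. -/
def p (g : CircleDeg1Lift) (n : ℕ) : ℤ := (Real.convergent (rot g) n).num

/-- The denominator `q_n` of the `n`-th convergent of the rotation number. -/
def q (g : CircleDeg1Lift) (n : ℕ) : ℕ := (Real.convergent (rot g) n).den

/-- `m_n(x) = g^{q_n}(x) - x - p_n`. -/
def m (g : CircleDeg1Lift) (n : ℕ) (x : ℝ) : ℝ := g^[q g n] x - x - p g n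

/-- `h` is an orientation preserving homeomorphism of `ℝ` commuting with `x ↦ x + 1` and
`h⁻¹ ∘ g ∘ h` is the translation by the rotation number. -/
structure IsLinearization (g : CircleDeg1Lift) (h : ℝ ≃ₜ ℝ) : Prop where
  mono : StrictMono h
  add_one : ∀ x, h (x + 1) = h x + 1
  conj : ∀ x, h.symm (g (h x)) = x + rot g

/-- The real flow `φ_t = h ∘ T_{tα} ∘ h⁻¹`. -/
def flow (g : CircleDeg1Lift) (h : ℝ ≃ₜ ℝ) (t x : ℝ) : ℝ := h (h.symm x + t * rot g)

/-- The coordinate `y₀` of `z = x₀ + i |m_n(x₀)| y₀`. -/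
def ycoord (g : CircleDeg1Lift) (n : ℕ) (z : ℂ) : ℝ := z.im / |m g n z.re|

/-- The complex flow: `x₀ + i |m_n(x₀)| y₀ ↦ φ_t(x₀) + i |m_n(φ_t(x₀))| y₀`. -/
def flowC (g : CircleDeg1Lift) (h : ℝ ≃ₜ ℝ) (n : ℕ) (t : ℝ) (z : ℂ) : ℂ :=
  ⟨flow g h t z.re, |m g n (flow g h t z.re)| * ycoord g n z⟩

/-- The flow line `Φ^{(n)}_z` through `z`. -/
def flowLine (g : CircleDeg1Lift) (h : ℝ ≃ₜ ℝ) (n : ℕ) (z : ℂ) : Set ℂ :=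
  range fun t : ℝ => flowC g h n t z

open Classical in
/-- The Poincaré distance (for the metric `|dz| / Im z`) of the upper half plane, with value `⊤`
if one of the points is not in the open upper half plane. -/
def distP (z w : ℂ) : ENNReal :=
  if h : 0 < z.im ∧ 0 < w.im then edist (⟨z, h.1⟩ : UpperHalfPlane) ⟨w, h.2⟩ else ⊤

/-- Hausdorff distance associated with the Poincaré distance. -/
def hausdorffP (A B : Set ℂ) : ENNReal :=
  (⨆ a ∈ A, ⨅ b ∈ B, distP a b) ⊔ (⨆ b ∈ B, ⨅ a ∈ A, distP a b)

/-- The open Poincaré ball. -/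
def ballP (c : ℂ) (r : ℝ) : Set ℂ := {z | distP z c < ENNReal.ofReal r}

/-- The open region between the real line and a curve `γ` in the upper half plane that is a graph
over the real line. -/
def between (γ : Set ℂ) : Set ℂ := {z | 0 < z.im ∧ ∃ w ∈ γ, w.re = z.re ∧ z.im < w.im}

/-- The closed region between the real line and a curve `γ` in the upper half plane that is a graph
over the real line. -/
def closedBetween (γ : Set ℂ) : Set ℂ := {z | 0 ≤ z.im ∧ ∃ w ∈ γ, w.re = z.re ∧ z.im ≤ w.im}

/-- `γ` is the lift of a closed curve around the circle, a periodic graph in the upper half plane;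
the iterates `g^j`, `0 ≤ j ≤ q_n`, are defined on the closed region under `γ` (hence near it); they
move `γ` by at most `C` in the Poincaré Hausdorff distance, and `g^{q_n}` (modulo integer
translations) moves each point of `γ` by at most `C` in the Poincaré distance. -/
structure IsQuasiInvariant (g : CircleDeg1Lift) (G : OpenPartialHomeomorph ℂ ℂ) (n : ℕ) (C : ℝ)
    (γ : Set ℂ) : Prop where
  graph : ∃ η : ℝ → ℝ, Continuous η ∧ (∀ x, 0 < η x) ∧ (∀ x, η (x + 1) = η x) ∧
    γ = {z | z.im = η z.re}
  defined : ∀ j ≤ q g n, closedBetween γ ⊆ (iter G j).source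
  hausdorff : ∀ j ≤ q g n, hausdorffP (iter G j '' γ) γ ≤ ENNReal.ofReal C
  return_close : ∀ z ∈ γ, distP (iter G (q g n) z - p g n) z ≤ ENNReal.ofReal C

/-- The set `S` separates `A` from `B` in `ℂ`: it is disjoint from both and no connected component
of its complement meets both. -/
def Separates (S A B : Set ℂ) : Prop :=
  Disjoint S A ∧ Disjoint S B ∧ ∀ a ∈ A, ∀ b ∈ B, b ∉ connectedComponentIn Sᶜ a

/-- The union of the Poincaré balls of radius `C` around the points `c + k`, `k ∈ ℤ`. -/
def ballsMod (c : ℂ) (C : ℝ) : Set ℂ := ⋃ k : ℤ, ballP (c + k) C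

/-- `w` is an iterate `g^i(w₀)`, for some `i ∈ ℤ`, of `w₀`. -/
def IsIterate (G : OpenPartialHomeomorph ℂ ℂ) (w₀ w : ℂ) : Prop :=
  ∃ i : ℤ, w₀ ∈ (ziter G i).source ∧ ziter G i w₀ = w

end

end CircleDyn

/-! Denjoy's argument is run quantitatively and then carried to the complex plane. The intervals
between `g^j(x)` and `g^j(g^{q_n}(x) - p_n)`, `j < q_{n+1}`, are disjoint modulo `1`, so their
lengths `|m_n(g^j x)|` sum to at most `1` (`sum_abs_m_le_one`). If `τ < 1/9` bounds `G''/G'`, then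
`g^l` with `l ≤ q_{n+1}` has distortion at most `e^τ` on such an interval. Every point is reached
from any orbit segment of length `q_{n+1}` by crossing at most three such intervals, so `Dg^{q_n}`
varies by at most `e^{4τ} ≤ 8/5` on the whole line. It takes the value `1`, hence `m_n` is
`3/5`-Lipschitz (`abs_m_sub_le`). This excludes wandering intervals, which gives `h`, and makes
`|m_n|` comparable at the nearby points used below.

The same sum bound controls complex orbits. Near a real point, `G` is multiplication by the
derivative up to a factor `ρ` with `|ρ - 1| ≤ e^{τ|z-x|} - 1`, and the product of these factors
along an orbit stays within `1/4` of `1`. So a point at height between `|m_n|/4` and `|m_n|` shadows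
the real orbit below it, at height comparable with `|m_n|`, up to time `q_{n+1}`
(`iter_sub_iterate`).

The curve is the graph of `3/4 |m_n|` (level `n + 1` of the theorem) and `z₀` is its point over `0`.
Points at such heights over nearby real points are at Poincaré distance less than `600`
(`distP_lt_of_isNear`), and a real orbit segment of length `q_{n+1}` comes near every real point
(`exists_isNear`). Hence the balls cover the curve and separate. An orbit that comes from above and
gets below the curve has a point below the curve whose image or preimage is not below; one step of
`G` scales the height and `|m_n|` almost equally, so that point has height at least `|m_n|/4`. From
there the orbit shadows a real orbit, which comes near every `g^j(x₀)`. -/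

namespace CircleDyn

/-! ### Continued fractions: errors `q_n ξ - p_n`, best approximation, covering by orbit segments.
-/

section Convergents

variable {ξ : ℝ}

theorem irrational_inv_fract (h : Irrational ξ) : Irrational (Int.fract ξ)⁻¹ := by
  rw [irrational_inv_iff, Int.fract]
  exact h.sub_intCast _

theorem fract_pos_of_irrational (h : Irrational ξ) : 0 < Int.fract ξ :=
  (Int.fract_nonneg ξ).lt_of_ne fun h0 => h ⟨⌊ξ⌋, by
    have := Int.floor_add_fract ξ
    rw [← h0, add_zero] at this
    exact_mod_cast this⟩

theorem one_lt_inv_fract (h : Irrational ξ) : 1 < (Int.fract ξ)⁻¹ :=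
  (one_lt_inv₀ (fract_pos_of_irrational h)).2 (Int.fract_lt_one ξ)

theorem one_le_convergent (n : ℕ) : ∀ {ξ : ℝ}, Irrational ξ → 1 < ξ → 1 ≤ ξ.convergent n := by
  induction n with
  | zero =>
    intro ξ _ h1
    rw [Real.convergent_zero]
    exact_mod_cast Int.le_floor.2 (by exact_mod_cast h1.le)
  | succ n ih =>
    intro ξ h h1
    rw [Real.convergent_succ]
    have h2 := ih (irrational_inv_fract h) (one_lt_inv_fract h)
    have h3 : (1 : ℚ) ≤ ⌊ξ⌋ := by exact_mod_cast Int.le_floor.2 (by exact_mod_cast h1.le)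
    have h4 : (0 : ℚ) ≤ (((Int.fract ξ)⁻¹).convergent n)⁻¹ := by positivity
    linarith

/-- The recursion for convergents peels off the first partial quotient, replacing `ξ` by `1/{ξ}`.
Knowing its effect on reduced fractions lets the facts below go by induction on `n` with `ξ`
arbitrary. -/
theorem num_den_int_add_inv (a : ℤ) {s : ℚ} (hs : 0 < s) :
    ((a : ℚ) + s⁻¹).num = a * s.num + s.den ∧ (((a : ℚ) + s⁻¹).den : ℤ) = s.num := by
  have hn : 0 < s.num := Rat.num_pos.2 hs
  have he : (a : ℚ) + s⁻¹ = ((a * s.num + s.den : ℤ) : ℚ) / (s.num : ℤ) := by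
    have h0 : (s.num : ℚ) ≠ 0 := by exact_mod_cast hn.ne'
    conv_lhs => rw [← Rat.num_div_den s]
    push_cast
    field_simp
  have hc : Nat.Coprime (a * s.num + s.den).natAbs s.num.natAbs := by
    rw [← Int.isCoprime_iff_nat_coprime]
    have : IsCoprime (s.den : ℤ) s.num :=
      (Int.isCoprime_iff_nat_coprime.2 (by simpa using s.reduced)).symm
    simpa [add_comm, mul_comm] using this.add_mul_left_left a
  rw [he]
  exact ⟨Rat.num_div_eq_of_coprime hn hc, Rat.den_div_eq_of_coprime hn hc⟩

theorem convergent_succ_num (h : Irrational ξ) (n : ℕ) :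
    (ξ.convergent (n + 1)).num = ⌊ξ⌋ * ((Int.fract ξ)⁻¹.convergent n).num +
      ((Int.fract ξ)⁻¹.convergent n).den := by
  rw [Real.convergent_succ]
  exact (num_den_int_add_inv _ (zero_lt_one.trans_le
    (one_le_convergent n (irrational_inv_fract h) (one_lt_inv_fract h)))).1

theorem convergent_succ_den (h : Irrational ξ) (n : ℕ) :
    ((ξ.convergent (n + 1)).den : ℤ) = ((Int.fract ξ)⁻¹.convergent n).num := by
  rw [Real.convergent_succ]
  exact (num_den_int_add_inv _ (zero_lt_one.trans_le
    (one_le_convergent n (irrational_inv_fract h) (one_lt_inv_fract h)))).2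

/-- The approximation error `q_n ξ - p_n` of the `n`-th convergent of `ξ`. -/
noncomputable def convErr (ξ : ℝ) (n : ℕ) : ℝ :=
  (ξ.convergent n).den * ξ - (ξ.convergent n).num

theorem convErr_zero (ξ : ℝ) : convErr ξ 0 = Int.fract ξ := by
  rw [convErr, Real.convergent_zero]
  simp only [Rat.num_intCast, Rat.den_intCast, Nat.cast_one, one_mul, Int.self_sub_floor]

theorem convErr_succ (h : Irrational ξ) (n : ℕ) :
    convErr ξ (n + 1) = -(Int.fract ξ * convErr (Int.fract ξ)⁻¹ n) := by
  have h0 := fract_pos_of_irrational h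
  have h1 : ((ξ.convergent (n + 1)).den : ℝ) = ((Int.fract ξ)⁻¹.convergent n).num := by
    exact_mod_cast convergent_succ_den h n
  rw [convErr, convErr, convergent_succ_num h, h1]
  push_cast
  have h2 : ξ = ⌊ξ⌋ + Int.fract ξ := (Int.floor_add_fract ξ).symm
  linear_combination ((Int.fract ξ)⁻¹.convergent n).num * h2 +
    ((Int.fract ξ)⁻¹.convergent n).den * mul_inv_cancel₀ h0.ne'

theorem convErr_sign (n : ℕ) : ∀ {ξ : ℝ}, Irrational ξ → 0 < (-1) ^ n * convErr ξ n := by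
  induction n with
  | zero =>
    intro ξ h
    simpa [convErr_zero] using fract_pos_of_irrational h
  | succ n ih =>
    intro ξ h
    rw [convErr_succ h]
    have := mul_pos (fract_pos_of_irrational h) (ih (irrational_inv_fract h))
    calc (0 : ℝ) < _ := this
      _ = _ := by ring

theorem convErr_ne_zero (h : Irrational ξ) (n : ℕ) : convErr ξ n ≠ 0 := fun h0 => by
  have := convErr_sign n h
  simp [h0] at this

theorem convErr_mul_succ_neg (h : Irrational ξ) (n : ℕ) : convErr ξ n * convErr ξ (n + 1) < 0 := by
  have := mul_pos (convErr_sign n h) (convErr_sign (n + 1) h)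
  have h2 : ((-1 : ℝ) ^ n) ^ 2 = 1 := by rw [← pow_mul, mul_comm, pow_mul]; simp
  have h3 : (-1) ^ n * convErr ξ n * ((-1) ^ (n + 1) * convErr ξ (n + 1)) =
    -(((-1) ^ n) ^ 2 * (convErr ξ n * convErr ξ (n + 1))) := by ring
  rw [h3, h2] at this
  linarith

theorem abs_convErr_succ_lt (n : ℕ) :
    ∀ {ξ : ℝ}, Irrational ξ → |convErr ξ (n + 1)| < |convErr ξ n| := by
  induction n with
  | zero =>
    intro ξ h
    rw [convErr_succ h, convErr_zero, convErr_zero, abs_neg, abs_mul]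
    have h0 := fract_pos_of_irrational h
    have h1 := Int.fract_lt_one (Int.fract ξ)⁻¹
    rw [Int.abs_fract, Int.abs_fract]
    nlinarith
  | succ n ih =>
    intro ξ h
    rw [convErr_succ h, convErr_succ h, abs_neg, abs_neg, abs_mul, abs_mul]
    exact mul_lt_mul_of_pos_left (ih (irrational_inv_fract h))
      (abs_pos.2 (fract_pos_of_irrational h).ne')

theorem convergent_det (n : ℕ) : ∀ {ξ : ℝ}, Irrational ξ →
    (ξ.convergent (n + 1)).num * (ξ.convergent n).den -
      (ξ.convergent n).num * (ξ.convergent (n + 1)).den = (-1) ^ n := by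
  induction n with
  | zero =>
    intro ξ h
    rw [convergent_succ_num h, convergent_succ_den h]
    simp
  | succ n ih =>
    intro ξ h
    rw [convergent_succ_num h, convergent_succ_den h, convergent_succ_num h, convergent_succ_den h]
    have := ih (irrational_inv_fract h)
    rw [pow_succ, ← this]
    ring

/-- This is the determinant identity with `ξ` inserted; the errors alternate in sign, so absolute
values turn the difference into a sum. -/
theorem den_mul_convErr (h : Irrational ξ) (n : ℕ) :
    (ξ.convergent (n + 1)).den * |convErr ξ n| + (ξ.convergent n).den * |convErr ξ (n + 1)| = 1 := by
  have hd : ((ξ.convergent (n + 1)).num : ℝ) * (ξ.convergent n).den -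
      (ξ.convergent n).num * (ξ.convergent (n + 1)).den = (-1) ^ n := by
    exact_mod_cast convergent_det n h
  have hs : ∀ k, |convErr ξ k| = (-1) ^ k * convErr ξ k := fun k => by
    have := convErr_sign k h
    have h1 : |(-1 : ℝ) ^ k * convErr ξ k| = |convErr ξ k| := by simp [abs_mul]
    rw [← h1, abs_of_pos this]
  have h2 : ((-1 : ℝ) ^ n) ^ 2 = 1 := by rw [← pow_mul, mul_comm, pow_mul]; simp
  rw [hs, hs, convErr, convErr, pow_succ]
  linear_combination (-1) ^ n * hd + h2

theorem convergent_num_lt_succ (n : ℕ) : ∀ {ξ : ℝ}, Irrational ξ → 1 < ξ →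
    (ξ.convergent n).num < (ξ.convergent (n + 1)).num ∧
      (ξ.convergent n).den ≤ (ξ.convergent (n + 1)).den := by
  induction n with
  | zero =>
    intro ξ h h1
    have hf : 1 ≤ ⌊ξ⌋ := Int.le_floor.2 (by exact_mod_cast h1.le)
    have hf' : 1 ≤ ⌊(Int.fract ξ)⁻¹⌋ := Int.le_floor.2 (by exact_mod_cast (one_lt_inv_fract h).le)
    constructor
    · rw [convergent_succ_num h]
      simp only [Real.convergent_zero, Rat.num_intCast, Rat.den_intCast]
      push_cast
      nlinarith
    · rw [Real.convergent_zero, Rat.den_intCast]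
      exact (ξ.convergent 1).den_pos
  | succ n ih =>
    intro ξ h h1
    have hf : 1 ≤ ⌊ξ⌋ := Int.le_floor.2 (by exact_mod_cast h1.le)
    obtain ⟨h2, h3⟩ := ih (irrational_inv_fract h) (one_lt_inv_fract h)
    constructor
    · rw [convergent_succ_num h, convergent_succ_num h (n + 1)]
      have : (((Int.fract ξ)⁻¹.convergent n).den : ℤ) ≤
        ((Int.fract ξ)⁻¹.convergent (n + 1)).den := by exact_mod_cast h3
      nlinarith
    · zify
      rw [convergent_succ_den h, convergent_succ_den h (n + 1)]
      exact h2.le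

theorem convergent_den_le_succ (h : Irrational ξ) (n : ℕ) :
    (ξ.convergent n).den ≤ (ξ.convergent (n + 1)).den := by
  cases n with
  | zero =>
    rw [Real.convergent_zero, Rat.den_intCast]
    exact (ξ.convergent 1).den_pos
  | succ n =>
    zify
    rw [convergent_succ_den h, convergent_succ_den h (n + 1)]
    exact (convergent_num_lt_succ n (irrational_inv_fract h) (one_lt_inv_fract h)).1.le

theorem le_convergent_den (h : Irrational ξ) (n : ℕ) : n ≤ (ξ.convergent n).den := by
  induction n with
  | zero => exact Nat.zero_le _
  | succ n ih =>
    cases n with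
    | zero => exact (ξ.convergent 1).den_pos
    | succ n =>
      refine Nat.succ_le_of_lt (ih.trans_lt ?_)
      zify
      rw [convergent_succ_den h, convergent_succ_den h (n + 1)]
      exact (convergent_num_lt_succ n (irrational_inv_fract h) (one_lt_inv_fract h)).1

theorem abs_convErr_le (h : Irrational ξ) (n : ℕ) :
    |convErr ξ n| ≤ 1 / (n + 1) := by
  have h1 := den_mul_convErr h n
  have h2 : ((n : ℝ) + 1) ≤ (ξ.convergent (n + 1)).den := by
    exact_mod_cast le_convergent_den h (n + 1)
  rw [le_div_iff₀ (by positivity)]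
  have h3 : 0 ≤ (ξ.convergent n).den * |convErr ξ (n + 1)| := by positivity
  nlinarith [abs_nonneg (convErr ξ n)]

/-- Best approximation: `|k ξ - l| ≥ |q_n ξ - p_n|` for `0 < |k| < q_{n+1}`. -/
theorem abs_convErr_le_of_lt_den (h : Irrational ξ) (n : ℕ) {k l : ℤ} (hk : k ≠ 0)
    (hk' : |k| < (ξ.convergent (n + 1)).den) : |convErr ξ n| ≤ |k * ξ - l| := by
  set pn := (ξ.convergent n).num with hpn
  set qn := ((ξ.convergent n).den : ℤ) with hqn
  set pm := (ξ.convergent (n + 1)).num with hpm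
  set qm := ((ξ.convergent (n + 1)).den : ℤ) with hqm
  have hd : pm * qn - pn * qm = (-1) ^ n := convergent_det n h
  have hqn0 : 0 < qn := Int.natCast_pos.2 (ξ.convergent n).den_pos
  have hqm0 : 0 < qm := Int.natCast_pos.2 (ξ.convergent (n + 1)).den_pos
  have he2 : ((-1 : ℤ) ^ n) ^ 2 = 1 := by rw [← pow_mul, mul_comm, pow_mul]; simp
  -- Two consecutive convergents form a basis of `ℤ²`. The bound on `|k|` forces `a ≠ 0` and `a b ≤
  -- 0`; since consecutive errors have opposite signs, the two terms of `k ξ - l` cannot cancel.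
  obtain ⟨a, b, hka, hlb⟩ : ∃ a b : ℤ, k = a * qn + b * qm ∧ l = a * pn + b * pm :=
    ⟨(-1) ^ n * (k * pm - l * qm), (-1) ^ n * (l * qn - k * pn),
      by linear_combination (-((-1) ^ n) * k) * hd - k * he2,
      by linear_combination (-((-1) ^ n) * l) * hd - l * he2⟩
  have hrep : (k * ξ - l : ℝ) = a * convErr ξ n + b * convErr ξ (n + 1) := by
    rw [hka, hlb, convErr, convErr]
    push_cast
    simp only [hqn, hqm, Int.cast_natCast]
    ring
  have ha : a ≠ 0 := by
    rintro rfl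
    have hb : b ≠ 0 := by
      rintro rfl
      simp [hka] at hk
    have : qm ≤ |k| := by
      rw [hka, zero_mul, zero_add, abs_mul, abs_of_pos hqm0]
      nlinarith [Int.one_le_abs hb]
    omega
  have hab : a * b ≤ 0 := by
    by_contra! hab
    have : qm ≤ |k| := by
      rcases lt_or_gt_of_ne ha with ha | ha
      · have hb : b < 0 := by nlinarith
        rw [hka, abs_of_nonpos (by nlinarith)]
        nlinarith
      · have hb : 0 < b := by nlinarith
        rw [hka, abs_of_nonneg (by nlinarith)]
        nlinarith
    omega
  have ha1 : (1 : ℝ) ≤ |(a : ℝ)| := by exact_mod_cast Int.one_le_abs ha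
  have hneg := convErr_mul_succ_neg h n
  have habR : (a : ℝ) * b ≤ 0 := by exact_mod_cast hab
  have hsq : (|(a : ℝ)| * |convErr ξ n|) ^ 2 ≤ |k * ξ - l| ^ 2 := by
    rw [mul_pow, sq_abs, sq_abs, sq_abs, hrep]
    nlinarith [mul_nonneg_of_nonpos_of_nonpos habR hneg.le, sq_nonneg (b * convErr ξ (n + 1))]
  have := abs_le_of_sq_le_sq hsq (abs_nonneg _)
  rw [abs_mul, abs_abs, abs_abs] at this
  nlinarith [abs_nonneg (convErr ξ n)]

/-- Every real number lies in one of the intervals spanned by `l ξ + k` and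
`l ξ + k + 3 (q_n ξ - p_n)` with `0 ≤ l < q_{n+1}`, `k ∈ ℤ`. -/
theorem exists_eq_mul_add_convErr (h : Irrational ξ) (n : ℕ) (s : ℝ) :
    ∃ l < (ξ.convergent (n + 1)).den, ∃ k : ℤ, ∃ t ∈ Ioo (0 : ℝ) 3,
      s = l * ξ + k + t * convErr ξ n := by
  set pm := (ξ.convergent (n + 1)).num with hpm
  set qm : ℕ := (ξ.convergent (n + 1)).den with hqm
  have hqm0 : 0 < qm := (ξ.convergent (n + 1)).den_pos
  have hqR : (0 : ℝ) < qm := by exact_mod_cast hqm0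
  obtain ⟨σ, hσ, hσn⟩ : ∃ σ : ℤ, (σ = 1 ∨ σ = -1) ∧ 0 < (σ : ℝ) * convErr ξ n := by
    rcases lt_or_gt_of_ne (convErr_ne_zero h n) with h0 | h0
    · exact ⟨-1, Or.inr rfl, by push_cast; linarith⟩
    · exact ⟨1, Or.inl rfl, by push_cast; linarith⟩
  have hσ2 : (σ : ℝ) * σ = 1 := by rcases hσ with rfl | rfl <;> norm_num
  have hσm : (σ : ℝ) * convErr ξ (n + 1) < 0 := by
    have := convErr_mul_succ_neg h n
    by_contra! h0
    nlinarith [mul_nonneg hσn.le h0]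
  have hdn : |convErr ξ n| = σ * convErr ξ n := by
    rw [← abs_of_pos hσn, abs_mul]; rcases hσ with rfl | rfl <;> norm_num
  have hdm : |convErr ξ (n + 1)| = -(σ * convErr ξ (n + 1)) := by
    rw [← abs_of_neg hσm, abs_mul]; rcases hσ with rfl | rfl <;> norm_num
  have hsum := den_mul_convErr h n
  have hlt := abs_convErr_succ_lt n h
  have hle : ((ξ.convergent n).den : ℝ) ≤ qm := by exact_mod_cast convergent_den_le_succ h n
  rw [hdn, hdm] at hsum
  rw [hdn, hdm] at hlt
  -- `c/q_{n+1}` is the last multiple of `1/q_{n+1}` strictly behind `s`, in the direction `σ` of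
  -- the `n`-th error. Bézout writes it as `l p_{n+1}/q_{n+1} + k`; replacing `p_{n+1}/q_{n+1}` by
  -- `ξ` moves it further back, by at most the next error. The total gap is below three errors, as
  -- `1/q_{n+1}` is less than two by `den_mul_convErr`.
  set c : ℤ := σ * (⌈σ * (qm * s)⌉ - 1) with hc
  have hc1 : 0 < σ * (qm * s - c) ∧ σ * (qm * s - c) ≤ 1 := by
    have e : (σ : ℝ) * (qm * s - c) = σ * (qm * s) - ⌈σ * (qm * s)⌉ + 1 := by
      rw [hc]; push_cast
      linear_combination -((⌈σ * (qm * s)⌉ : ℝ) - 1) * hσ2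
    rw [e]
    have h1 := Int.le_ceil (σ * (qm * s))
    have h2 := Int.ceil_lt_add_one (σ * (qm * s))
    constructor <;> linarith
  have hcop : IsCoprime pm (qm : ℤ) :=
    Int.isCoprime_iff_nat_coprime.2 (by
    rw [Int.natAbs_natCast]; exact (ξ.convergent (n + 1)).reduced)
  obtain ⟨u, v, huv⟩ := hcop
  set l : ℤ := (c * u) % qm with hl
  have hl0 : 0 ≤ l := Int.emod_nonneg _ (by exact_mod_cast hqm0.ne')
  have hlq : l < qm := Int.emod_lt_of_pos _ (by exact_mod_cast hqm0)
  obtain ⟨k, hk⟩ : ∃ k : ℤ, c = l * pm + k * qm :=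
    ⟨c * v + pm * ((c * u) / qm), by
      rw [hl, Int.emod_def]; linear_combination (-c) * huv⟩
  have hkR : (c : ℝ) = l * pm + k * qm := by exact_mod_cast hk
  have hlR : (l : ℝ) ≤ qm := by exact_mod_cast hlq.le
  have hl0R : (0 : ℝ) ≤ l := by exact_mod_cast hl0
  have hdef : convErr ξ (n + 1) = qm * ξ - pm := rfl
  have key : σ * (s - l * ξ - k) * qm = σ * (qm * s - c) - l * (σ * convErr ξ (n + 1)) := by
    rw [hkR, hdef]; ring
  refine ⟨l.toNat, by omega, k, (s - l * ξ - k) / convErr ξ n, ⟨?_, ?_⟩, ?_⟩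
  · have h1 : 0 < σ * (s - l * ξ - k) := by
      have : 0 < σ * (s - l * ξ - k) * qm := by rw [key]; nlinarith
      exact pos_of_mul_pos_left this hqR.le
    have h2 : (s - l * ξ - k) / convErr ξ n = σ * (s - l * ξ - k) / (σ * convErr ξ n) := by
      rw [mul_div_mul_left]; intro h0; simp [h0] at hσn
    rw [h2]; positivity
  · have h2 : (s - l * ξ - k) / convErr ξ n = σ * (s - l * ξ - k) / (σ * convErr ξ n) := by
      rw [mul_div_mul_left]; intro h0; simp [h0] at hσn
    rw [h2, div_lt_iff₀ hσn]
    have : σ * (s - l * ξ - k) * qm < 3 * (σ * convErr ξ n) * qm := by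
      rw [key]; nlinarith
    exact lt_of_mul_lt_mul_right this hqR.le
  · have : ((l.toNat : ℕ) : ℝ) = l := by exact_mod_cast Int.toNat_of_nonneg hl0
    rw [this, div_mul_cancel₀ _ (convErr_ne_zero h n)]
    ring

end Convergents

/-! ### Combinatorics of real orbits: the order is that of the rotation. -/

section Order

variable {g F : CircleDeg1Lift}

/-- The first return map `g^{q_n} - p_n`. -/
noncomputable def ret (g : CircleDeg1Lift) (n : ℕ) (x : ℝ) : ℝ := g^[q g n] x - p g n

theorem ret_sub_self (n : ℕ) (x : ℝ) : ret g n x - x = m g n x := by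
  rw [ret, m]; ring

theorem iterate_sub_int (j : ℕ) (x : ℝ) (k : ℤ) : g^[j] (x - k) = g^[j] x - k := by
  rw [← CircleDeg1Lift.coe_pow, CircleDeg1Lift.map_sub_int]

theorem iterate_add_int (j : ℕ) (x : ℝ) (k : ℤ) : g^[j] (x + k) = g^[j] x + k := by
  rw [← CircleDeg1Lift.coe_pow, CircleDeg1Lift.map_add_int]

theorem iterate_ret (n j : ℕ) (x : ℝ) : g^[j] (ret g n x) = ret g n (g^[j] x) := by
  rw [ret, ret, iterate_sub_int, ← Function.iterate_add_apply, ← Function.iterate_add_apply,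
    add_comm]

theorem m_add_int (n : ℕ) (x : ℝ) (k : ℤ) : m g n (x + k) = m g n x := by
  rw [m, m, iterate_add_int]; ring

theorem semiconj_iterate (hF : ∀ x, F (g x) = F x + rot g) (j : ℕ) (x : ℝ) :
    F (g^[j] x) = F x + j * rot g := by
  induction j with
  | zero => simp
  | succ j ih =>
    rw [Function.iterate_succ_apply', hF, ih]
    push_cast
    ring

theorem semiconj_ret (hF : ∀ x, F (g x) = F x + rot g) (n : ℕ) (x : ℝ) :
    F (ret g n x) = F x + convErr (rot g) n := by
  rw [ret, CircleDeg1Lift.map_sub_int, semiconj_iterate hF, convErr, q, p]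
  ring

/-- `F` is only known to be monotone here, because these facts serve to prove that it is injective;
only strict inequalities pull back. In `orbit_le` irrationality disposes of equality. -/
theorem lt_of_semiconj_lt {x y : ℝ} (h : F x < F y) : x < y :=
  lt_of_not_ge fun h' => h.not_ge (F.mono h')

theorem orbit_le (hF : ∀ x, F (g x) = F x + rot g) (hα : Irrational (rot g)) (x : ℝ) {i j : ℕ}
    {k l : ℤ} (h : i * rot g + k ≤ j * rot g + l) : g^[i] x + k ≤ g^[j] x + l := by
  rcases h.lt_or_eq with h | h
  · refine (lt_of_semiconj_lt (F := F) ?_).le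
    rw [CircleDeg1Lift.map_add_int, CircleDeg1Lift.map_add_int, semiconj_iterate hF,
      semiconj_iterate hF]
    linarith
  · have hij : i = j := by
      by_contra hij
      have hij' : ((i : ℤ) - j : ℤ) ≠ 0 := by omega
      refine (hα.intCast_mul hij').ne_int (l - k) ?_
      push_cast
      linarith
    subst hij
    have : (k : ℝ) = l := by linarith
    rw [this]

theorem m_pos (hF : ∀ x, F (g x) = F x + rot g) {n : ℕ} (h : 0 < convErr (rot g) n) (x : ℝ) :
    0 < m g n x := by
  rw [← ret_sub_self, sub_pos]
  refine lt_of_semiconj_lt (F := F) ?_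
  rw [semiconj_ret hF]
  linarith

theorem m_neg (hF : ∀ x, F (g x) = F x + rot g) {n : ℕ} (h : convErr (rot g) n < 0) (x : ℝ) :
    m g n x < 0 := by
  rw [← ret_sub_self, sub_neg]
  refine lt_of_semiconj_lt (F := F) ?_
  rw [semiconj_ret hF]
  linarith

theorem abs_m_pos (hF : ∀ x, F (g x) = F x + rot g) (hα : Irrational (rot g)) (n : ℕ) (x : ℝ) :
    0 < |m g n x| := by
  rcases lt_or_gt_of_ne (convErr_ne_zero hα n) with h | h
  · exact abs_pos.2 (m_neg hF h x).ne
  · exact abs_pos.2 (m_pos hF h x).ne'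

theorem sum_length_le {ι : Type*} (s : Finset ι) (a b : ι → ℝ) {c d : ℝ} (hcd : c ≤ d)
    (hab : ∀ i ∈ s, a i ≤ b i) (hc : ∀ i ∈ s, c ≤ a i) (hd : ∀ i ∈ s, b i ≤ d)
    (hdisj : ∀ i ∈ s, ∀ j ∈ s, i ≠ j → b i ≤ a j ∨ b j ≤ a i) :
    ∑ i ∈ s, (b i - a i) ≤ d - c := by
  have h1 : MeasureTheory.volume (⋃ i ∈ s, Ioo (a i) (b i)) =
      ∑ i ∈ s, MeasureTheory.volume (Ioo (a i) (b i)) := by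
    refine MeasureTheory.measure_biUnion_finset (fun i hi j hj hij => ?_)
      fun i _ => measurableSet_Ioo
    rw [Function.onFun, Set.disjoint_left]
    intro t ht ht'
    rcases hdisj i hi j hj hij with h | h
    · linarith [ht.2, ht'.1]
    · linarith [ht.1, ht'.2]
  have h2 : MeasureTheory.volume (⋃ i ∈ s, Ioo (a i) (b i)) ≤ MeasureTheory.volume (Icc c d) :=
    MeasureTheory.measure_mono (iUnion₂_subset fun i hi t ht =>
      ⟨(hc i hi).trans ht.1.le, ht.2.le.trans (hd i hi)⟩)
  rw [h1] at h2
  simp only [Real.volume_Ioo, Real.volume_Icc] at h2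
  rw [← ENNReal.ofReal_sum_of_nonneg fun i hi => sub_nonneg.2 (hab i hi)] at h2
  exact (ENNReal.ofReal_le_ofReal_iff (sub_nonneg.2 hcd)).1 h2

theorem abs_convErr_le_of_ne (hα : Irrational (rot g)) (n : ℕ) {i j : ℕ} (hi : i < q g (n + 1))
    (hj : j < q g (n + 1)) (hij : i ≠ j) (k l : ℤ) :
    |convErr (rot g) n| ≤ |(i * rot g + k) - (j * rot g + l)| := by
  have := abs_convErr_le_of_lt_den hα n (k := (i : ℤ) - j) (l := l - k) (by omega)
    (by rw [q] at hi hj; rw [abs_lt]; constructor <;> omega)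
  refine this.trans_eq (congrArg _ ?_)
  push_cast
  ring

/-- The intervals `[g^j x, g^j (ret x)]`, `j < q_{n+1}`, are disjoint modulo `1`. -/
theorem sum_abs_m_le_one (hF : ∀ x, F (g x) = F x + rot g) (hα : Irrational (rot g)) (n : ℕ)
    (x : ℝ) : ∑ j ∈ Finset.range (q g (n + 1)), |m g n (g^[j] x)| ≤ 1 := by
  have hsep := @abs_convErr_le_of_ne g hα n
  have hdef : convErr (rot g) n = q g n * rot g - p g n := rfl
  have hle1 : |convErr (rot g) n| ≤ 1 := (abs_convErr_le hα n).trans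
    ((div_le_one (by positivity)).2 (by linarith [Nat.cast_nonneg (α := ℝ) n]))
  have hq0 : 0 < q g (n + 1) := (Real.convergent (rot g) (n + 1)).den_pos
  have hR : ∀ (j : ℕ) (k : ℤ), ret g n (g^[j] x) + k = g^[j + q g n] x + (k - p g n : ℤ) := by
    intro j k
    rw [ret, ← Function.iterate_add_apply, add_comm (q g n)]
    push_cast
    ring
  have hm : ∀ (j : ℕ) (k : ℤ), m g n (g^[j] x) = (ret g n (g^[j] x) + k) - (g^[j] x + k) := by
    intro j k
    rw [← ret_sub_self]; ring
  rcases lt_or_gt_of_ne (convErr_ne_zero hα n) with h | h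
  -- Here the return map moves points to the left. Rounding `j α` up puts the right endpoints at or
  -- below `x`; the left ones stay above `x - 1` because distinct orbit points are at least one
  -- error apart in the rotation. The other sign is the mirror image, with floors and `[x, x + 1]`.
  · rw [abs_of_neg h] at hsep hle1
    have e : ∀ j ∈ Finset.range (q g (n + 1)), |m g n (g^[j] x)| =
        (g^[j] x + (-⌈j * rot g⌉ : ℤ)) - (ret g n (g^[j] x) + (-⌈j * rot g⌉ : ℤ)) := by
      intro j _
      rw [abs_of_neg (m_neg hF h _), hm j (-⌈j * rot g⌉)]
      ring
    rw [Finset.sum_congr rfl e]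
    have := sum_length_le (Finset.range (q g (n + 1)))
      (fun j => ret g n (g^[j] x) + (-⌈j * rot g⌉ : ℤ)) (fun j => g^[j] x + (-⌈j * rot g⌉ : ℤ))
      (c := x - 1) (d := x) (by linarith) ?_ ?_ ?_ ?_
    · linarith
    · intro j _
      have := m_neg hF h (g^[j] x)
      rw [← ret_sub_self] at this
      linarith
    · intro j hj
      have := orbit_le hF hα x (i := 0) (j := j + q g n) (k := -1) (l := -⌈j * rot g⌉ - p g n) ?_
      · rw [hR]
        simpa [sub_eq_add_neg] using this
      · have h1 := Int.ceil_lt_add_one (j * rot g)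
        push_cast
        by_cases hj0 : j = 0
        · subst hj0
          simp
          linarith
        · have h2 := hsep (Finset.mem_range.1 hj) hq0 hj0 (-⌈j * rot g⌉) (-1)
          rw [abs_of_pos (by push_cast; linarith)] at h2
          push_cast at h2
          linarith
    · intro j hj
      have := orbit_le hF hα x (i := j) (j := 0) (k := -⌈j * rot g⌉) (l := 0) ?_
      · simpa using this
      · have h1 := Int.le_ceil (j * rot g)
        push_cast
        linarith
    · intro i hi j hj hij
      have h2 := hsep (Finset.mem_range.1 hi) (Finset.mem_range.1 hj) hij (-⌈i * rot g⌉)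
        (-⌈j * rot g⌉)
      rw [hR, hR]
      rcases le_abs.1 h2 with h3 | h3
      · right
        refine orbit_le hF hα x ?_
        push_cast at h3 ⊢
        linarith
      · left
        refine orbit_le hF hα x ?_
        push_cast at h3 ⊢
        linarith
  · rw [abs_of_pos h] at hsep hle1
    have e : ∀ j ∈ Finset.range (q g (n + 1)), |m g n (g^[j] x)| =
        (ret g n (g^[j] x) + (-⌊j * rot g⌋ : ℤ)) - (g^[j] x + (-⌊j * rot g⌋ : ℤ)) := by
      intro j _
      rw [abs_of_pos (m_pos hF h _), hm j (-⌊j * rot g⌋)]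
    rw [Finset.sum_congr rfl e]
    have := sum_length_le (Finset.range (q g (n + 1)))
      (fun j => g^[j] x + (-⌊j * rot g⌋ : ℤ)) (fun j => ret g n (g^[j] x) + (-⌊j * rot g⌋ : ℤ))
      (c := x) (d := x + 1) (by linarith) ?_ ?_ ?_ ?_
    · linarith
    · intro j _
      have := m_pos hF h (g^[j] x)
      rw [← ret_sub_self] at this
      linarith
    · intro j hj
      have := orbit_le hF hα x (i := 0) (j := j) (k := 0) (l := -⌊j * rot g⌋) ?_
      · simpa using this
      · have h1 := Int.floor_le (j * rot g)
        push_cast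
        linarith
    · intro j hj
      have := orbit_le hF hα x (i := j + q g n) (j := 0) (k := -⌊j * rot g⌋ - p g n) (l := 1) ?_
      · rw [hR]
        simpa [sub_eq_add_neg] using this
      · have h1 := Int.lt_floor_add_one (j * rot g)
        push_cast
        by_cases hj0 : j = 0
        · subst hj0
          simp
          linarith
        · have h2 := hsep (Finset.mem_range.1 hj) hq0 hj0 (-⌊j * rot g⌋) 1
          rw [abs_of_neg (by push_cast; linarith)] at h2
          push_cast at h2
          linarith
    · intro i hi j hj hij
      have h2 := hsep (Finset.mem_range.1 hi) (Finset.mem_range.1 hj) hij (-⌊i * rot g⌋)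
        (-⌊j * rot g⌋)
      rw [hR, hR]
      rcases le_abs.1 h2 with h3 | h3
      · right
        refine orbit_le hF hα x ?_
        push_cast at h3 ⊢
        linarith
      · left
        refine orbit_le hF hα x ?_
        push_cast at h3 ⊢
        linarith

/-- Every point `u` lies between `a` and `ret³ a` for some point `a` of the orbit segment
`g^l v`, `l < q_{n+1}`, modulo `1`. -/
theorem exists_mem_uIcc_ret (hF : ∀ x, F (g x) = F x + rot g) (hα : Irrational (rot g)) (n : ℕ)
    (u v : ℝ) : ∃ l < q g (n + 1), ∃ k : ℤ,
      u ∈ uIcc (g^[l] v + k) (ret g n (ret g n (ret g n (g^[l] v + k)))) := by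
  obtain ⟨l, hl, k, t, ht, hs⟩ := exists_eq_mul_add_convErr hα n (F u - F v)
  refine ⟨l, hl, k, ?_⟩
  set a := g^[l] v + k with ha
  have hFa : F a = F v + l * rot g + k := by
    rw [ha, CircleDeg1Lift.map_add_int, semiconj_iterate hF]
  have hu : F u = F a + t * convErr (rot g) n := by rw [hFa]; linarith
  have h3 : F (ret g n (ret g n (ret g n a))) = F a + 3 * convErr (rot g) n := by
    rw [semiconj_ret hF, semiconj_ret hF, semiconj_ret hF]; ring
  rw [mem_uIcc]
  rcases lt_or_gt_of_ne (convErr_ne_zero hα n) with h | h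
  · right
    constructor <;> refine (lt_of_semiconj_lt (F := F) ?_).le
    · rw [hu, h3]; nlinarith [ht.2]
    · rw [hu]; nlinarith [ht.1]
  · left
    constructor <;> refine (lt_of_semiconj_lt (F := F) ?_).le
    · rw [hu]; nlinarith [ht.1]
    · rw [hu, h3]; nlinarith [ht.2]

end Order

/-! ### Denjoy distortion and the Lipschitz bound on `m_n`. -/

section Distortion

/-- `g'` is the positive derivative of `g`, with `log g'` Lipschitz with constant `τ ≤ 1/9`. -/
structure IsSmallDistortion (g : CircleDeg1Lift) (g' : ℝ → ℝ) (τ : ℝ) : Prop where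
  nonneg : 0 ≤ τ
  le : τ ≤ 1 / 9
  hasDerivAt : ∀ x, HasDerivAt g (g' x) x
  pos : ∀ x, 0 < g' x
  bound : ∀ u v, g' u ≤ Real.exp (τ * |u - v|) * g' v

/-- The derivative of `g^l` as the product of `g'` along the orbit. -/
noncomputable def iterDeriv (g : CircleDeg1Lift) (g' : ℝ → ℝ) (l : ℕ) (x : ℝ) : ℝ :=
  ∏ i ∈ Finset.range l, g' (g^[i] x)

variable {g F : CircleDeg1Lift} {g' : ℝ → ℝ} {τ : ℝ}

theorem iterDeriv_succ (l : ℕ) (x : ℝ) :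
    iterDeriv g g' (l + 1) x = iterDeriv g g' l x * g' (g^[l] x) :=
  Finset.prod_range_succ _ _

theorem iterDeriv_add (k l : ℕ) (x : ℝ) :
    iterDeriv g g' (k + l) x = iterDeriv g g' k x * iterDeriv g g' l (g^[k] x) := by
  rw [iterDeriv, Finset.prod_range_add, iterDeriv, iterDeriv]
  refine congrArg _ (Finset.prod_congr rfl fun i _ => ?_)
  rw [← Function.iterate_add_apply, add_comm]

theorem iterDeriv_pos (hg : IsSmallDistortion g g' τ) (l : ℕ) (x : ℝ) :
    0 < iterDeriv g g' l x :=
  Finset.prod_pos fun _ _ => hg.pos _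

theorem hasDerivAt_iterate (hg : IsSmallDistortion g g' τ) (l : ℕ) (x : ℝ) :
    HasDerivAt g^[l] (iterDeriv g g' l x) x := by
  induction l with
  | zero => simpa [iterDeriv] using hasDerivAt_id x
  | succ l ih =>
    rw [Function.iterate_succ', iterDeriv_succ, mul_comm]
    exact (hg.hasDerivAt _).comp x ih

theorem deriv_add_int (hg : IsSmallDistortion g g' τ) (x : ℝ) (k : ℤ) : g' (x + k) = g' x := by
  have h1 : HasDerivAt (fun y => g (y + k)) (g' (x + k)) x := (hg.hasDerivAt _).comp_add_const x k
  simp only [CircleDeg1Lift.map_add_int] at h1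
  exact h1.unique ((hg.hasDerivAt x).add_const _)

theorem iterDeriv_add_int (hg : IsSmallDistortion g g' τ) (l : ℕ) (x : ℝ) (k : ℤ) :
    iterDeriv g g' l (x + k) = iterDeriv g g' l x :=
  Finset.prod_congr rfl fun i _ => by rw [iterate_add_int, deriv_add_int hg]

theorem abs_iterate_sub_le (n i : ℕ) {x u v : ℝ} (hu : u ∈ uIcc x (ret g n x))
    (hv : v ∈ uIcc x (ret g n x)) : |g^[i] u - g^[i] v| ≤ |m g n (g^[i] x)| := by
  have hm : Monotone g^[i] := g.monotone.iterate i
  have h : ∀ w ∈ uIcc x (ret g n x), g^[i] w ∈ uIcc (g^[i] x) (ret g n (g^[i] x)) := by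
    intro w hw
    rw [← iterate_ret]
    exact hm.mapsTo_uIcc hw
  have h1 := abs_sub_le_of_uIcc_subset_uIcc (uIcc_subset_uIcc (h v hv) (h u hu))
  rwa [ret_sub_self] at h1

/-- Denjoy distortion: `g^l`, `l ≤ q_{n+1}`, has distortion `e^τ` on a fundamental interval. -/
theorem iterDeriv_le (hg : IsSmallDistortion g g' τ) (hF : ∀ x, F (g x) = F x + rot g)
    (hα : Irrational (rot g)) {n l : ℕ} (hl : l ≤ q g (n + 1)) {x u v : ℝ}
    (hu : u ∈ uIcc x (ret g n x)) (hv : v ∈ uIcc x (ret g n x)) :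
    iterDeriv g g' l u ≤ Real.exp τ * iterDeriv g g' l v := by
  have h1 : iterDeriv g g' l u ≤
      ∏ i ∈ Finset.range l, (Real.exp (τ * |m g n (g^[i] x)|) * g' (g^[i] v)) := by
    refine Finset.prod_le_prod (fun i _ => (hg.pos _).le) fun i _ => (hg.bound _ (g^[i] v)).trans ?_
    refine mul_le_mul_of_nonneg_right (Real.exp_le_exp.2 ?_) (hg.pos _).le
    exact mul_le_mul_of_nonneg_left (abs_iterate_sub_le n i hu hv) hg.nonneg
  rw [Finset.prod_mul_distrib, ← Real.exp_sum, ← Finset.mul_sum] at h1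
  refine h1.trans (mul_le_mul_of_nonneg_right (Real.exp_le_exp.2 ?_) (iterDeriv_pos hg l v).le)
  have h2 : ∑ i ∈ Finset.range l, |m g n (g^[i] x)| ≤ 1 :=
    (Finset.sum_le_sum_of_subset_of_nonneg (Finset.range_mono hl)
      fun _ _ _ => abs_nonneg _).trans (sum_abs_m_le_one hF hα n x)
  nlinarith [hg.nonneg]

theorem exp_four_mul_le (hg : IsSmallDistortion g g' τ) :
    Real.exp τ * (Real.exp τ * (Real.exp τ * Real.exp τ)) ≤ 8 / 5 := by
  rw [← Real.exp_add, ← Real.exp_add, ← Real.exp_add]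
  have h1 : τ + (τ + (τ + τ)) ≤ 4 / 9 := by linarith [hg.le]
  refine (Real.exp_le_exp.2 h1).trans ?_
  -- Ninth powers reduce the bound to `e^4 ≤ (8/5)^9`.
  have h2 : Real.exp (4 / 9) ^ 9 = Real.exp 1 ^ 4 := by
    rw [← Real.exp_nat_mul, ← Real.exp_nat_mul]; norm_num
  have h3 := Real.exp_one_lt_d9
  refine le_of_pow_le_pow_left₀ (n := 9) (by norm_num) (by norm_num) ?_
  rw [h2]
  refine (pow_le_pow_left₀ (Real.exp_pos _).le h3.le 4).trans ?_
  norm_num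

theorem q_le_succ (hα : Irrational (rot g)) (n : ℕ) : q g n ≤ q g (n + 1) :=
  convergent_den_le_succ hα n

/-- Distortion is paid four times: at most three fundamental intervals lead from `u` to a point `a`
of the orbit of `v`, and one more factor leads from `a` to `v`. The condition `τ ≤ 1/9` enters
through `e^{4τ} ≤ 8/5`. -/
theorem iterDeriv_q_le (hg : IsSmallDistortion g g' τ) (hF : ∀ x, F (g x) = F x + rot g)
    (hα : Irrational (rot g)) (n : ℕ) (u v : ℝ) :
    iterDeriv g g' (q g n) u ≤ 8 / 5 * iterDeriv g g' (q g n) v := by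
  have hq := q_le_succ hα n
  have hret : ∀ x, ret g n x ∈ uIcc x (ret g n x) := fun x => right_mem_uIcc
  obtain ⟨l, hl, k, hu⟩ := exists_mem_uIcc_ret hF hα n u v
  set a := g^[l] v + k with ha
  set D := iterDeriv g g' (q g n) with hD
  have hE := Real.exp_pos τ
  have h1E : 1 ≤ Real.exp τ := Real.one_le_exp hg.nonneg
  have hDpos : ∀ x, 0 < D x := iterDeriv_pos hg _
  have step : ∀ {x w}, w ∈ uIcc x (ret g n x) → D w ≤ Real.exp τ * D x := fun hw =>
    iterDeriv_le hg hF hα hq hw left_mem_uIcc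
  have hua : D u ≤ Real.exp τ * (Real.exp τ * (Real.exp τ * D a)) := by
    have s1 := step (hret a)
    have s2 := step (hret (ret g n a))
    rcases uIcc_subset_uIcc_union_uIcc (b := ret g n a) hu with h | h
    · have s := step h
      have e1 : D a ≤ Real.exp τ * D a := le_mul_of_one_le_left (hDpos a).le h1E
      calc D u ≤ Real.exp τ * D a := s
        _ ≤ Real.exp τ * (Real.exp τ * D a) := by gcongr
        _ ≤ _ := by gcongr
    · rcases uIcc_subset_uIcc_union_uIcc (b := ret g n (ret g n a)) h with h | h
      · have s := step h
        have e1 : D a ≤ Real.exp τ * D a := le_mul_of_one_le_left (hDpos a).le h1E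
        calc D u ≤ Real.exp τ * D (ret g n a) := s
          _ ≤ Real.exp τ * (Real.exp τ * D a) := by gcongr
          _ ≤ _ := by gcongr
      · have s := step h
        calc D u ≤ Real.exp τ * D (ret g n (ret g n a)) := s
          _ ≤ Real.exp τ * (Real.exp τ * D (ret g n a)) := by gcongr
          _ ≤ _ := by gcongr
  have hav : D a ≤ Real.exp τ * D v := by
    rw [ha, hD, iterDeriv_add_int hg]
    -- The chain rule for `g^{l + q_n}` in both orders trades the change of base point of `Dg^{q_n}`
    -- for the distortion of `g^l` between `v` and its return.
    have e1 : iterDeriv g g' l v * iterDeriv g g' (q g n) (g^[l] v) =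
        iterDeriv g g' (q g n) v * iterDeriv g g' l (ret g n v) := by
      have : iterDeriv g g' l (g^[q g n] v) = iterDeriv g g' l (ret g n v) := by
        rw [← iterDeriv_add_int hg l (ret g n v) (p g n), ret, sub_add_cancel]
      rw [← this, ← iterDeriv_add, ← iterDeriv_add, add_comm]
    have e2 : iterDeriv g g' l (ret g n v) ≤ Real.exp τ * iterDeriv g g' l v :=
      iterDeriv_le hg hF hα hl.le (hret v) left_mem_uIcc
    have e3 := iterDeriv_pos hg l v
    refine le_of_mul_le_mul_left ?_ e3
    rw [e1]
    calc _ ≤ iterDeriv g g' (q g n) v * (Real.exp τ * iterDeriv g g' l v) := by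
          gcongr
          exact (iterDeriv_pos hg _ _).le
      _ = _ := by ring
  calc D u ≤ Real.exp τ * (Real.exp τ * (Real.exp τ * D a)) := hua
    _ ≤ Real.exp τ * (Real.exp τ * (Real.exp τ * (Real.exp τ * D v))) := by gcongr
    _ = (Real.exp τ * (Real.exp τ * (Real.exp τ * Real.exp τ))) * D v := by ring
    _ ≤ 8 / 5 * D v := mul_le_mul_of_nonneg_right (exp_four_mul_le hg) (hDpos v).le

theorem exists_iterDeriv_eq_one (hg : IsSmallDistortion g g' τ) (l : ℕ) :
    ∃ v, iterDeriv g g' l v = 1 := by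
  obtain ⟨c, -, hc⟩ := exists_hasDerivAt_eq_slope g^[l] (iterDeriv g g' l) zero_lt_one
    (fun x _ => (hasDerivAt_iterate hg l x).continuousAt.continuousWithinAt)
    fun x _ => hasDerivAt_iterate hg l x
  refine ⟨c, hc.trans ?_⟩
  have := iterate_add_int (g := g) l 0 1
  rw [Int.cast_one, zero_add] at this
  rw [this]
  ring

/-- `m_n` is a contraction. -/
theorem abs_m_sub_le (hg : IsSmallDistortion g g' τ) (hF : ∀ x, F (g x) = F x + rot g)
    (hα : Irrational (rot g)) (n : ℕ) (u v : ℝ) : |m g n u - m g n v| ≤ 3 / 5 * |u - v| := by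
  -- Comparison with a point of derivative `1` puts `Dg^{q_n}` in `[5/8, 8/5]`, so `|Dm_n| ≤ 3/5`.
  obtain ⟨c, hc⟩ := exists_iterDeriv_eq_one hg (q g n)
  have h : ∀ x ∈ (univ : Set ℝ),
      HasDerivWithinAt (m g n) (iterDeriv g g' (q g n) x - 1) univ x := fun x _ =>
    (((hasDerivAt_iterate hg (q g n) x).sub (hasDerivAt_id x)).sub_const _).hasDerivWithinAt
  refine convex_univ.norm_image_sub_le_of_norm_hasDerivWithin_le (C := 3 / 5) h (fun x _ => ?_)
    (mem_univ v) (mem_univ u)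
  have h1 := iterDeriv_q_le hg hF hα n x c
  have h2 := iterDeriv_q_le hg hF hα n c x
  rw [hc] at h1 h2
  rw [Real.norm_eq_abs, abs_le]
  constructor <;> linarith

end Distortion

/-! ### Denjoy's theorem and uniform decay of `m_n`. -/

section Linearization

variable {g F : CircleDeg1Lift} {g' : ℝ → ℝ} {τ : ℝ}

theorem strictMono_of_isSmallDistortion (hg : IsSmallDistortion g g' τ) : StrictMono g :=
  strictMono_of_hasDerivAt_pos hg.hasDerivAt hg.pos

theorem bijective_of_isSmallDistortion (hg : IsSmallDistortion g g' τ) : Function.Bijective g :=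
  ⟨(strictMono_of_isSmallDistortion hg).injective, g.continuous_iff_surjective.1
    (continuous_iff_continuousAt.2 fun x => (hg.hasDerivAt x).continuousAt)⟩

theorem exists_semiconj (hg : IsSmallDistortion g g' τ) :
    ∃ F : CircleDeg1Lift, ∀ x, F (g x) = F x + rot g := by
  obtain ⟨F, hF⟩ := CircleDeg1Lift.semiconj_of_isUnit_of_translationNumber_eq
    (f₁ := g) (f₂ := CircleDeg1Lift.translate (Multiplicative.ofAdd (rot g)))
    (CircleDeg1Lift.isUnit_iff_bijective.2 (bijective_of_isSmallDistortion hg)) (Units.isUnit _)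
    (CircleDeg1Lift.translationNumber_translate _).symm
  refine ⟨F, fun x => ?_⟩
  rw [hF.eq, CircleDeg1Lift.translate_apply, add_comm]

/-- Denjoy's theorem: there are no wandering intervals. -/
theorem semiconj_strictMono (hg : IsSmallDistortion g g' τ) (hF : ∀ x, F (g x) = F x + rot g)
    (hα : Irrational (rot g)) : StrictMono F := by
  refine F.strictMono_iff_injective.2 fun a b hab => ?_
  by_contra hne
  wlog hlt : a < b generalizing a b
  · exact this b a hab.symm (Ne.symm hne) (lt_of_le_of_ne (not_lt.1 hlt) (Ne.symm hne))
  have hpos : ∀ k : ℕ, 0 < convErr (rot g) (2 * k) := fun k => by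
    simpa [pow_mul] using convErr_sign (2 * k) hα
  -- The even returns of a wandering interval `[a, b]` keep length at least `2/5 (b - a)`. As `F` is
  -- constant on each and the even errors decrease, these returns are disjoint and march left by a
  -- definite amount, yet they must stay to the right of `a`.
  have hlen : ∀ k : ℕ, 2 / 5 * (b - a) ≤ ret g (2 * k) b - ret g (2 * k) a := by
    intro k
    have := abs_m_sub_le hg hF hα (2 * k) b a
    rw [abs_of_pos (sub_pos.2 hlt)] at this
    have h1 := ret_sub_self (g := g) (2 * k) a
    have h2 := ret_sub_self (g := g) (2 * k) b
    linarith [(abs_le.1 this).1]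
  have hdec : ∀ k : ℕ, ret g (2 * k) a ≤ ret g 0 a - k * (2 / 5 * (b - a)) := by
    intro k
    induction k with
    | zero => simp
    | succ k ih =>
      have h1 : ret g (2 * (k + 1)) b < ret g (2 * k) a := by
        refine lt_of_semiconj_lt (F := F) ?_
        rw [semiconj_ret hF, semiconj_ret hF, hab]
        have h2 := abs_convErr_succ_lt (2 * k) hα
        have h3 := abs_convErr_succ_lt (2 * k + 1) hα
        have h4 := hpos (k + 1)
        rw [show 2 * (k + 1) = 2 * k + 1 + 1 by ring] at h4 ⊢
        rw [abs_of_pos h4] at h3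
        rw [abs_of_pos (hpos k)] at h2
        linarith
      have h2 := hlen (k + 1)
      push_cast
      linarith
  obtain ⟨k, hk⟩ := exists_nat_gt ((ret g 0 a - a) / (2 / 5 * (b - a)))
  rw [div_lt_iff₀ (by linarith)] at hk
  have h1 := m_pos hF (hpos k) a
  rw [← ret_sub_self] at h1
  linarith [hdec k]

theorem semiconj_denseRange (hF : ∀ x, F (g x) = F x + rot g) (hα : Irrational (rot g)) :
    DenseRange F := by
  rw [DenseRange, Metric.dense_iff]
  intro s ε hε
  obtain ⟨n, hn⟩ := exists_nat_one_div_lt (show 0 < ε / 3 by positivity)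
  obtain ⟨l, -, k, t, ht, hs⟩ := exists_eq_mul_add_convErr hα n (s - F 0)
  refine ⟨F (g^[l] 0 + k), ?_, mem_range_self _⟩
  have h1 := (abs_convErr_le hα n).trans_lt hn
  rw [Metric.mem_ball, Real.dist_eq, CircleDeg1Lift.map_add_int, semiconj_iterate hF,
    show F 0 + l * rot g + k - s = -(t * convErr (rot g) n) by linarith, abs_neg, abs_mul,
    abs_of_pos ht.1]
  nlinarith [ht.1, ht.2, abs_nonneg (convErr (rot g) n)]

theorem exists_isLinearization (hg : IsSmallDistortion g g' τ) (hα : Irrational (rot g)) :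
    ∃ h : ℝ ≃ₜ ℝ, IsLinearization g h := by
  obtain ⟨F, hF⟩ := exists_semiconj hg
  have hmono := semiconj_strictMono hg hF hα
  have hsurj : Function.Surjective F := F.continuous_iff_surjective.1
    (F.monotone.continuous_of_denseRange (semiconj_denseRange hF hα))
  let e : ℝ ≃o ℝ := hmono.orderIsoOfSurjective F hsurj
  have he : ∀ x, e x = F x := fun _ => rfl
  refine ⟨e.symm.toHomeomorph, e.symm.strictMono, fun x => ?_, fun x => ?_⟩
  · change e.symm (x + 1) = e.symm x + 1
    rw [OrderIso.symm_apply_eq, he, F.map_add_one, ← he, OrderIso.apply_symm_apply]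
  · change e (g (e.symm x)) = x + rot g
    rw [he, hF, ← he, OrderIso.apply_symm_apply]

theorem IsLinearization.exists_semiconj {h : ℝ ≃ₜ ℝ} (hh : IsLinearization g h) :
    ∃ F : CircleDeg1Lift, (∀ x, F x = h.symm x) ∧ ∀ x, F (g x) = F x + rot g := by
  refine ⟨⟨⟨h.symm, fun x y hxy => ?_⟩, fun x => ?_⟩, fun _ => rfl, fun x => ?_⟩
  · rw [← hh.mono.le_iff_le]
    simpa using hxy
  · change h.symm (x + 1) = h.symm x + 1
    rw [h.symm_apply_eq, hh.add_one, h.apply_symm_apply]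
  · change h.symm (g x) = h.symm x + rot g
    simpa using hh.conj (h.symm x)

theorem uniformContinuous_of_isLinearization {h : ℝ ≃ₜ ℝ} (hh : IsLinearization g h) {ε : ℝ}
    (hε : 0 < ε) : ∃ δ > 0, ∀ x y, |x - y| < δ → |h x - h y| < ε := by
  have hc := isCompact_Icc.uniformContinuousOn_of_continuous
    (h.continuous.continuousOn (s := Icc (-1 : ℝ) 2))
  rw [Metric.uniformContinuousOn_iff] at hc
  obtain ⟨δ, hδ, H⟩ := hc ε hε
  have hint : ∀ (k : ℤ) x, h (x + k) = h x + k := by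
    have : ∀ x, h (x + 1) = h x + 1 := hh.add_one
    let f : CircleDeg1Lift := ⟨⟨h, hh.mono.monotone⟩, this⟩
    exact fun k x => f.map_add_int x k
  refine ⟨min δ 1, by positivity, fun x y hxy => ?_⟩
  have h1 := hxy.trans_le (min_le_left _ _)
  have h2 := abs_lt.1 (hxy.trans_le (min_le_right _ _))
  have h3 := Int.floor_le x
  have h4 := Int.lt_floor_add_one x
  have := H (x + (-⌊x⌋ : ℤ)) ⟨by push_cast; linarith, by push_cast; linarith⟩
    (y + (-⌊x⌋ : ℤ)) ⟨by push_cast; linarith, by push_cast; linarith⟩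
    (by rwa [Real.dist_eq, add_sub_add_right_eq_sub])
  rwa [hint, hint, Real.dist_eq, add_sub_add_right_eq_sub] at this

theorem eventually_abs_m_lt (hα : Irrational (rot g)) {h : ℝ ≃ₜ ℝ} (hh : IsLinearization g h)
    {ε : ℝ} (hε : 0 < ε) : ∃ n₀ : ℕ, ∀ n ≥ n₀, ∀ x, |m g n x| < ε := by
  obtain ⟨F, hFh, hF⟩ := hh.exists_semiconj
  obtain ⟨δ, hδ, H⟩ := uniformContinuous_of_isLinearization hh hε
  obtain ⟨n₀, hn₀⟩ := exists_nat_one_div_lt hδ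
  refine ⟨n₀, fun n hn x => ?_⟩
  have h1 : |convErr (rot g) n| < δ := by
    refine (abs_convErr_le hα n).trans_lt (lt_of_le_of_lt ?_ hn₀)
    gcongr
  have h2 : h.symm (ret g n x) = h.symm x + convErr (rot g) n := by
    rw [← hFh, ← hFh, semiconj_ret hF]
  have := H (h.symm (ret g n x)) (h.symm x) (by rwa [h2, add_sub_cancel_left])
  rwa [h.apply_symm_apply, h.apply_symm_apply, ret_sub_self] at this

end Linearization

theorem exp_le_inv_one_sub {x : ℝ} (hx : x < 1) : Real.exp x ≤ (1 - x)⁻¹ := by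
  have h := Real.add_one_le_exp (-x)
  rw [Real.exp_neg] at h
  rw [le_inv_comm₀ (Real.exp_pos x) (by linarith)]
  linarith

/-! ### Complex distortion of one step of `G`. -/

section Analytic

theorem isOpen_strip (Δ : ℝ) : IsOpen (strip Δ) :=
  isOpen_lt (continuous_abs.comp continuous_im) continuous_const

theorem convex_strip (Δ : ℝ) : Convex ℝ (strip Δ) := by
  have : strip Δ = Complex.imLm ⁻¹' (Ioo (-Δ) Δ) := by
    ext z; simp [strip, abs_lt]
  rw [this]
  exact (convex_Ioo _ _).linear_preimage _

theorem ofReal_mem_strip {Δ : ℝ} (hΔ : 0 < Δ) (x : ℝ) : (x : ℂ) ∈ strip Δ := by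
  simpa [strip] using hΔ

theorem mem_strip_of_norm_lt {Δ : ℝ} {z : ℂ} {x : ℝ} (h : ‖z - x‖ < Δ) : z ∈ strip Δ := by
  have := abs_im_le_norm (z - x)
  simp only [sub_im, ofReal_im, sub_zero] at this
  exact this.trans_lt h

variable {Δ τ : ℝ} {g : CircleDeg1Lift} {G : OpenPartialHomeomorph ℂ ℂ}

theorem IsAnalyticDiffeo.strip_subset (hG : IsAnalyticDiffeo Δ g G) : strip Δ ⊆ G.source :=
  subset_closure.trans hG.strip_source

theorem IsAnalyticDiffeo.analyticOnNhd (hG : IsAnalyticDiffeo Δ g G) :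
    AnalyticOnNhd ℂ G (strip Δ) :=
  (hG.holo.mono hG.strip_subset).analyticOnNhd (isOpen_strip Δ)

theorem IsAnalyticDiffeo.not_eqOn_deriv_zero (hΔ : 0 < Δ) (hG : IsAnalyticDiffeo Δ g G) :
    ¬ EqOn (deriv G) 0 (strip Δ) := by
  intro h
  have h1 := (isOpen_strip Δ).is_const_of_deriv_eq_zero (convex_strip Δ).isPreconnected
    hG.analyticOnNhd.differentiableOn h (ofReal_mem_strip hΔ 0) (ofReal_mem_strip hΔ 1)
  rw [hG.real, hG.real, Complex.ofReal_inj] at h1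
  have h2 := g.map_add_one 0
  rw [zero_add] at h2
  linarith

/-- The bound on `G'' / G'` holds without division, also at possible zeros of `G'`. -/
theorem IsAnalyticDiffeo.norm_deriv_deriv_le (hΔ : 0 < Δ) (hG : IsAnalyticDiffeo Δ g G)
    (hτ : ∀ z ∈ strip Δ, ‖logDeriv (deriv G) z‖ ≤ τ) {z : ℂ} (hz : z ∈ strip Δ) :
    ‖deriv (deriv G) z‖ ≤ τ * ‖deriv G z‖ := by
  -- Division by zero gives `0`, so the hypothesis says nothing at a zero of `G'`. Such zeros would
  -- be isolated, and the inequality extends to them by continuity.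
  have hne : ∀ w ∈ strip Δ, deriv G w ≠ 0 → ‖deriv (deriv G) w‖ ≤ τ * ‖deriv G w‖ := by
    intro w hw hw0
    have := hτ w hw
    rwa [logDeriv_apply, norm_div, div_le_iff₀ (norm_pos_iff.2 hw0)] at this
  have ha : AnalyticOnNhd ℂ (deriv G) (strip Δ) := hG.analyticOnNhd.deriv
  rcases (ha z hz).eventually_eq_zero_or_eventually_ne_zero with h | h
  · exact absurd (ha.eqOn_zero_of_preconnected_of_eventuallyEq_zero
      (convex_strip Δ).isPreconnected hz h) (hG.not_eqOn_deriv_zero hΔ)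
  · have h1 := ((ha.deriv z hz).continuousAt.norm).tendsto.mono_left
      (nhdsWithin_le_nhds (s := {z}ᶜ))
    have h2 := (((ha z hz).continuousAt.norm).const_mul τ).tendsto.mono_left
      (nhdsWithin_le_nhds (s := {z}ᶜ))
    refine le_of_tendsto_of_tendsto h1 h2 ?_
    filter_upwards [h, nhdsWithin_le_nhds ((isOpen_strip Δ).mem_nhds hz)] with w hw hw'
    exact hne w hw' hw

theorem gronwallBound_zero_mul (K c x : ℝ) :
    gronwallBound 0 K (K * c) x = c * (Real.exp (K * x) - 1) := by
  by_cases hK : K = 0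
  · simp [hK, gronwallBound_K0]
  · rw [gronwallBound_of_K_ne_0 hK]
    field_simp
    ring

/-- Grönwall on the segment from `x` to `z`, applied to `G' - G'(x)`. No logarithm of `G'` is
needed, and a zero of `G'` would force `G' = 0` throughout the strip. -/
theorem IsAnalyticDiffeo.norm_deriv_sub_le (hΔ : 0 < Δ) (hG : IsAnalyticDiffeo Δ g G)
    (hτ : ∀ z ∈ strip Δ, ‖logDeriv (deriv G) z‖ ≤ τ) {x z : ℂ} (hx : x ∈ strip Δ)
    (hz : z ∈ strip Δ) :
    ‖deriv G z - deriv G x‖ ≤ ‖deriv G x‖ * (Real.exp (τ * ‖z - x‖) - 1) := by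
  have ha : AnalyticOnNhd ℂ (deriv G) (strip Δ) := hG.analyticOnNhd.deriv
  have hseg : ∀ t ∈ Icc (0 : ℝ) 1, x + t * (z - x) ∈ strip Δ := by
    intro t ht
    have := (convex_strip Δ).add_smul_sub_mem hx hz ht
    simpa using this
  have hd : ∀ t ∈ Icc (0 : ℝ) 1, HasDerivAt (fun t : ℝ => deriv G (x + t * (z - x)) - deriv G x)
      (deriv (deriv G) (x + t * (z - x)) * (z - x)) t := by
    intro t ht
    have h1 : HasDerivAt (fun s : ℝ => x + (s : ℂ) * (z - x)) (z - x) t := by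
      simpa using ((ofRealCLM.hasDerivAt (x := t)).mul_const (z - x)).const_add x
    have h2 := (ha _ (hseg t ht)).differentiableAt.hasDerivAt
    exact (HasDerivAt.comp t h2 h1).sub_const _
  have := norm_le_gronwallBound_of_norm_deriv_right_le (δ := 0) (K := τ * ‖z - x‖)
    (ε := τ * ‖z - x‖ * ‖deriv G x‖)
    (fun t ht => (hd t ht).continuousAt.continuousWithinAt)
    (fun t ht => (hd t ⟨ht.1, ht.2.le⟩).hasDerivWithinAt) (by simp) (fun t ht => ?_) 1
    (right_mem_Icc.2 zero_le_one)
  · rw [gronwallBound_zero_mul] at this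
    simpa using this
  · have hm := hseg t ⟨ht.1, ht.2.le⟩
    have h1 := hG.norm_deriv_deriv_le hΔ hτ hm
    have hτ0 : 0 ≤ τ := (norm_nonneg _).trans (hτ x hx)
    have h2 : ‖deriv G (x + t * (z - x))‖ ≤
        ‖deriv G (x + t * (z - x)) - deriv G x‖ + ‖deriv G x‖ := by
      simpa using norm_add_le (deriv G (x + t * (z - x)) - deriv G x) (deriv G x)
    rw [norm_mul]
    calc _ ≤ τ * (‖deriv G (x + t * (z - x)) - deriv G x‖ + ‖deriv G x‖) * ‖z - x‖ :=
          mul_le_mul_of_nonneg_right (h1.trans (mul_le_mul_of_nonneg_left h2 hτ0)) (norm_nonneg _)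
      _ = _ := by ring

theorem IsAnalyticDiffeo.norm_sub_sub_le (hΔ : 0 < Δ) (hG : IsAnalyticDiffeo Δ g G)
    (hτ : ∀ z ∈ strip Δ, ‖logDeriv (deriv G) z‖ ≤ τ) {x z : ℂ} (hx : x ∈ strip Δ)
    (hz : z ∈ strip Δ) :
    ‖G z - G x - deriv G x * (z - x)‖ ≤
      ‖deriv G x‖ * (Real.exp (τ * ‖z - x‖) - 1) * ‖z - x‖ := by
  have hτ0 : 0 ≤ τ := (norm_nonneg _).trans (hτ x hx)
  have hsub : segment ℝ x z ⊆ strip Δ := (convex_strip Δ).segment_subset hx hz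
  have hd : ∀ w ∈ segment ℝ x z, HasDerivWithinAt (fun w => G w - deriv G x * w)
      (deriv G w - deriv G x) (segment ℝ x z) w := by
    intro w hw
    have h1 := (hG.analyticOnNhd w (hsub hw)).differentiableAt.hasDerivAt
    have h2 := (hasDerivAt_id w).const_mul (deriv G x)
    rw [mul_one] at h2
    exact (h1.sub h2).hasDerivWithinAt
  have := (convex_segment x z).norm_image_sub_le_of_norm_hasDerivWithin_le
    (C := ‖deriv G x‖ * (Real.exp (τ * ‖z - x‖) - 1)) hd (fun w hw => ?_)
    (left_mem_segment ℝ x z) (right_mem_segment ℝ x z)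
  · refine (congrArg _ ?_).trans_le this
    ring
  · refine (hG.norm_deriv_sub_le hΔ hτ hx (hsub hw)).trans ?_
    have : ‖w - x‖ ≤ ‖z - x‖ := norm_sub_le_of_mem_segment hw
    gcongr

theorem IsAnalyticDiffeo.deriv_eq_ofReal (hΔ : 0 < Δ) (hG : IsAnalyticDiffeo Δ g G) (x : ℝ) :
    HasDerivAt g (deriv G x).re x ∧ deriv G x = ((deriv G x).re : ℂ) := by
  have h1 := (hG.analyticOnNhd x (ofReal_mem_strip hΔ x)).differentiableAt.hasDerivAt
  have h2 : HasDerivAt g (deriv G x).re x := by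
    simpa [hG.real] using h1.real_of_complex
  refine ⟨h2, ?_⟩
  have h3 := h1.comp_ofReal
  simp only [hG.real] at h3
  exact h3.unique h2.ofReal_comp

theorem IsAnalyticDiffeo.isSmallDistortion (hΔ : 0 < Δ) (hG : IsAnalyticDiffeo Δ g G)
    (hτ : ∀ z ∈ strip Δ, ‖logDeriv (deriv G) z‖ ≤ τ) (hτ9 : τ < 1 / 9) :
    IsSmallDistortion g (fun x => (deriv G x).re) τ := by
  have hnn : ∀ x : ℝ, 0 ≤ (deriv G x).re := fun x => by
    rw [← (hG.deriv_eq_ofReal hΔ x).1.deriv]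
    exact g.monotone.deriv_nonneg
  refine ⟨(norm_nonneg _).trans (hτ _ (ofReal_mem_strip hΔ 0)), hτ9.le,
    fun x => (hG.deriv_eq_ofReal hΔ x).1, fun x => (hnn x).lt_of_ne fun h0 => ?_, fun u v => ?_⟩
  · refine hG.not_eqOn_deriv_zero hΔ fun z hz => ?_
    have h1 := hG.norm_deriv_sub_le hΔ hτ (ofReal_mem_strip hΔ x) hz
    have h2 : deriv G x = 0 := by rw [(hG.deriv_eq_ofReal hΔ x).2, ← h0, ofReal_zero]
    simpa [h2] using h1
  · have h1 := hG.norm_deriv_sub_le hΔ hτ (ofReal_mem_strip hΔ v) (ofReal_mem_strip hΔ u)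
    rw [(hG.deriv_eq_ofReal hΔ u).2, (hG.deriv_eq_ofReal hΔ v).2, ← ofReal_sub, ← ofReal_sub,
      norm_real, norm_real, norm_real, Real.norm_of_nonneg (hnn v), Real.norm_eq_abs,
      Real.norm_eq_abs] at h1
    have h2 := (abs_le.1 h1).2
    linarith

/-- The error is put in multiplicative form so that the factors `ρ` simply multiply along an orbit.
-/
theorem IsAnalyticDiffeo.exists_eq_mul (hΔ : 0 < Δ) (hG : IsAnalyticDiffeo Δ g G)
    (hτ : ∀ z ∈ strip Δ, ‖logDeriv (deriv G) z‖ ≤ τ) (hτ9 : τ < 1 / 9) (x : ℝ) {z : ℂ}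
    (hz : z ∈ strip Δ) : ∃ ρ : ℂ, G z - g x = (deriv G x).re * (z - x) * ρ ∧
      ‖ρ - 1‖ ≤ Real.exp (τ * ‖z - x‖) - 1 := by
  by_cases hzx : z = x
  · exact ⟨1, by simp [hzx, hG.real], by simp [hzx]⟩
  have hpos := (hG.isSmallDistortion hΔ hτ hτ9).pos x
  have hzx' : z - x ≠ 0 := sub_ne_zero.2 hzx
  have hne : ((deriv G x).re * (z - x) : ℂ) ≠ 0 :=
    mul_ne_zero (ofReal_ne_zero.2 hpos.ne') hzx'
  refine ⟨(G z - g x) / ((deriv G x).re * (z - x)), (mul_div_cancel₀ _ hne).symm, ?_⟩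
  have h1 := hG.norm_sub_sub_le hΔ hτ (ofReal_mem_strip hΔ x) hz
  rw [(hG.deriv_eq_ofReal hΔ x).2, hG.real] at h1
  rw [div_sub_one hne, norm_div, div_le_iff₀ (norm_pos_iff.2 hne), norm_mul]
  linarith

/-- The image of a small disc centred at a real point contains a disc. -/
theorem IsAnalyticDiffeo.exists_preimage (hΔ : 0 < Δ) (hG : IsAnalyticDiffeo Δ g G)
    (hτ : ∀ z ∈ strip Δ, ‖logDeriv (deriv G) z‖ ≤ τ) (hτ9 : τ < 1 / 9) (x : ℝ) {r : ℝ}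
    (hr : 0 < r) (hrΔ : r < Δ) (hre : Real.exp (τ * r) ≤ 11 / 10) {w : ℂ}
    (hw : ‖w - g x‖ < 9 / 20 * (deriv G x).re * r) :
    ∃ z : ℂ, ‖z - x‖ ≤ r ∧ G z = w := by
  have hs := hG.isSmallDistortion hΔ hτ hτ9
  have hpos := hs.pos x
  have hstrip : Metric.closedBall (x : ℂ) r ⊆ strip Δ := fun z hz =>
    mem_strip_of_norm_lt ((mem_closedBall_iff_norm.1 hz).trans_lt hrΔ)
  have hlow : ∀ z : ℂ, ‖z - x‖ ≤ r → 9 / 10 * (deriv G x).re * ‖z - x‖ ≤ ‖G z - G x‖ := by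
    intro z hz
    obtain ⟨ρ, h1, h2⟩ := hG.exists_eq_mul hΔ hτ hτ9 x (hstrip (mem_closedBall_iff_norm.2 hz))
    have h3 : Real.exp (τ * ‖z - x‖) ≤ 11 / 10 :=
      (Real.exp_le_exp.2 (mul_le_mul_of_nonneg_left hz hs.nonneg)).trans hre
    have h4 : 9 / 10 ≤ ‖ρ‖ := by
      have := norm_sub_norm_le 1 (1 - ρ)
      rw [norm_one, sub_sub_cancel, norm_sub_rev] at this
      linarith
    rw [hG.real, h1, norm_mul, norm_mul, norm_real, Real.norm_of_nonneg hpos.le]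
    have h5 : 0 ≤ (deriv G x).re * ‖z - x‖ := by positivity
    nlinarith
  have hd : DiffContOnCl ℂ G (Metric.ball (x : ℂ) r) := by
    refine DifferentiableOn.diffContOnCl ?_
    rw [closure_ball _ hr.ne']
    exact hG.analyticOnNhd.differentiableOn.mono hstrip
  have hfreq : ∃ᶠ z in nhds (x : ℂ), G z ≠ G x := by
    refine Filter.Frequently.filter_mono (f := nhdsWithin (x : ℂ) {(x : ℂ)}ᶜ) ?_ nhdsWithin_le_nhds
    refine Filter.Eventually.frequently ?_
    filter_upwards [self_mem_nhdsWithin,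
      nhdsWithin_le_nhds (Metric.closedBall_mem_nhds (x : ℂ) hr)] with z hz hz' h0
    have := hlow z (mem_closedBall_iff_norm.1 hz')
    rw [h0, sub_self, norm_zero] at this
    have h6 : 0 < ‖z - x‖ := norm_pos_iff.2 (sub_ne_zero.2 hz)
    have : 0 < 9 / 10 * (deriv G x).re * ‖z - x‖ := by positivity
    linarith
  -- The quantitative open mapping theorem loses a factor `2`: a lower bound `ε` on the circle gives
  -- a disc of radius `ε / 2`, whence `9/20`.
  have := hd.ball_subset_image_closedBall hr (ε := 9 / 10 * (deriv G x).re * r)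
    (fun z hz => by
      have h := hlow z (mem_sphere_iff_norm.1 hz).le
      rwa [mem_sphere_iff_norm.1 hz] at h) hfreq
  obtain ⟨z, hz, hzw⟩ := this (show w ∈ Metric.ball (G x) _ by
    rw [mem_ball_iff_norm, hG.real]; linarith)
  exact ⟨z, mem_closedBall_iff_norm.1 hz, hzw⟩

end Analytic

/-! ### Shadowing of real orbits by complex ones. -/

section Orbit

variable {Δ τ : ℝ} {g F : CircleDeg1Lift} {G : OpenPartialHomeomorph ℂ ℂ} {g' : ℝ → ℝ}

theorem exists_mem_uIcc_slope {f f' : ℝ → ℝ} (hf : ∀ x, HasDerivAt f (f' x) x) (a b : ℝ) :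
    ∃ c ∈ uIcc a b, f b - f a = f' c * (b - a) := by
  have main : ∀ a b : ℝ, a < b → ∃ c ∈ uIcc a b, f b - f a = f' c * (b - a) := by
    intro a b hab
    obtain ⟨c, hc, h⟩ := exists_hasDerivAt_eq_slope f f' hab
      (fun x _ => (hf x).continuousAt.continuousWithinAt) fun x _ => hf x
    refine ⟨c, Icc_subset_uIcc ⟨hc.1.le, hc.2.le⟩, ?_⟩
    rw [h, div_mul_cancel₀ _ (sub_pos.2 hab).ne']
  rcases lt_trichotomy a b with h | h | h
  · exact main a b h
  · exact ⟨a, left_mem_uIcc, by simp [h]⟩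
  · obtain ⟨c, hc, e⟩ := main b a h
    exact ⟨c, uIcc_comm b a ▸ hc, by linarith⟩

/-- `g^l` carries the fundamental interval at `x` onto the one at `g^l x`, so the ratio of lengths
is `Dg^l` at an intermediate point. -/
theorem iterDeriv_mul_abs_m_le (hg : IsSmallDistortion g g' τ) (hF : ∀ x, F (g x) = F x + rot g)
    (hα : Irrational (rot g)) {n l : ℕ} (hl : l ≤ q g (n + 1)) (x : ℝ) :
    iterDeriv g g' l x * |m g n x| ≤ Real.exp τ * |m g n (g^[l] x)| ∧
      |m g n (g^[l] x)| ≤ Real.exp τ * (iterDeriv g g' l x * |m g n x|) := by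
  obtain ⟨c, hc, e⟩ := exists_mem_uIcc_slope (hasDerivAt_iterate hg l) x (ret g n x)
  rw [iterate_ret, ret_sub_self, ret_sub_self] at e
  have h1 := iterDeriv_le hg hF hα hl (left_mem_uIcc (b := ret g n x)) hc
  have h2 := iterDeriv_le hg hF hα hl hc (left_mem_uIcc (b := ret g n x))
  rw [e, abs_mul, abs_of_pos (iterDeriv_pos hg l c)]
  constructor
  · calc _ ≤ Real.exp τ * iterDeriv g g' l c * |m g n x| :=
          mul_le_mul_of_nonneg_right h1 (abs_nonneg _)
      _ = _ := by ring
  · calc _ ≤ Real.exp τ * iterDeriv g g' l x * |m g n x| :=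
          mul_le_mul_of_nonneg_right h2 (abs_nonneg _)
      _ = _ := by ring

theorem mem_iter_succ_source {l : ℕ} {z : ℂ} :
    z ∈ (iter G (l + 1)).source ↔ z ∈ (iter G l).source ∧ iter G l z ∈ G.source := by
  rw [iter, OpenPartialHomeomorph.trans_source]
  rfl

theorem iter_succ_apply (l : ℕ) (z : ℂ) : iter G (l + 1) z = G (iter G l z) := rfl

theorem exp_le_of_isSmallDistortion (hg : IsSmallDistortion g g' τ) : Real.exp τ ≤ 9 / 8 := by
  refine (exp_le_inv_one_sub (by linarith [hg.le])).trans ?_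
  rw [inv_le_comm₀ (by linarith [hg.le]) (by norm_num)]
  linarith [hg.le]

/-- A complex orbit starting at distance at most `|m_n(x)|` from a real point `x` shadows the real
orbit up to the time `q_{n+1}`. -/
theorem IsAnalyticDiffeo.iter_sub_iterate (hΔ : 0 < Δ) (hG : IsAnalyticDiffeo Δ g G)
    (hτ : ∀ z ∈ strip Δ, ‖logDeriv (deriv G) z‖ ≤ τ) (hτ9 : τ < 1 / 9)
    (hF : ∀ x, F (g x) = F x + rot g) (hα : Irrational (rot g)) {n : ℕ}
    (hm : ∀ x, |m g n x| < Δ / 2) {x : ℝ} {z : ℂ} (hz : ‖z - x‖ ≤ |m g n x|) {l : ℕ}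
    (hl : l ≤ q g (n + 1)) :
    z ∈ (iter G l).source ∧ ∃ P : ℂ, iter G l z - (g^[l] x : ℝ) =
      (iterDeriv g (fun x => (deriv G x).re) l x : ℝ) * (z - x) * P ∧ ‖P - 1‖ ≤ 1 / 4 := by
  have hg := hG.isSmallDistortion hΔ hτ hτ9
  set D := iterDeriv g (fun x => (deriv G x).re) with hD
  have hE := exp_le_of_isSmallDistortion hg
  -- `T` bounds the accumulated logarithmic error. The constant is `9/8 · 5/4`, bounds for `e^τ` and
  -- for `|P|`; it gives `T ≤ 5/32` and `e^T ≤ 32/27 < 5/4`, which closes the induction.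
  set T : ℕ → ℝ := fun l => 45 / 32 * (τ * ∑ i ∈ Finset.range l, |m g n (g^[i] x)|) with hT
  have hTexp : ∀ l ≤ q g (n + 1), Real.exp (T l) ≤ 5 / 4 := by
    intro l hl
    have h2 : ∑ i ∈ Finset.range l, |m g n (g^[i] x)| ≤ 1 :=
      (Finset.sum_le_sum_of_subset_of_nonneg (Finset.range_mono hl)
        fun _ _ _ => abs_nonneg _).trans (sum_abs_m_le_one hF hα n x)
    have h3 : T l ≤ 5 / 32 := by
      have : τ * ∑ i ∈ Finset.range l, |m g n (g^[i] x)| ≤ τ :=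
        mul_le_of_le_one_right hg.nonneg h2
      simp only [hT]
      linarith [hg.le]
    refine (Real.exp_le_exp.2 h3).trans ((exp_le_inv_one_sub (by norm_num)).trans ?_)
    norm_num
  suffices H : z ∈ (iter G l).source ∧ ∃ P : ℂ, iter G l z - (g^[l] x : ℝ) =
      (D l x : ℝ) * (z - x) * P ∧ ‖P - 1‖ ≤ Real.exp (T l) - 1 by
    obtain ⟨h1, P, h2, h3⟩ := H
    exact ⟨h1, P, h2, by linarith [hTexp l hl]⟩
  induction l with
  | zero => exact ⟨mem_univ _, 1, by simp [hD, iter, iterDeriv], by simp [hT]⟩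
  | succ l ih =>
    obtain ⟨h1, P, h2, h3⟩ := ih (by omega)
    have hl' : l ≤ q g (n + 1) := by omega
    have hP : ‖P‖ ≤ Real.exp (T l) := by
      have := norm_add_le (P - 1) 1
      rw [sub_add_cancel, norm_one] at this
      linarith
    have hDp : 0 < D l x := iterDeriv_pos hg l x
    have hdist : ‖iter G l z - (g^[l] x : ℝ)‖ ≤ 45 / 32 * |m g n (g^[l] x)| := by
      rw [h2, norm_mul, norm_mul, norm_real, Real.norm_of_nonneg hDp.le]
      have h4 := (iterDeriv_mul_abs_m_le hg hF hα hl' x).1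
      have h5 : D l x * ‖z - x‖ ≤ D l x * |m g n x| := by gcongr
      calc D l x * ‖z - x‖ * ‖P‖ ≤ D l x * |m g n x| * (5 / 4) :=
            mul_le_mul h5 (hP.trans (hTexp l hl')) (norm_nonneg _) (by positivity)
        _ ≤ Real.exp τ * |m g n (g^[l] x)| * (5 / 4) := by gcongr
        _ ≤ 9 / 8 * |m g n (g^[l] x)| * (5 / 4) := by gcongr
        _ = _ := by ring
    have hstrip : iter G l z ∈ strip Δ := by
      refine mem_strip_of_norm_lt (hdist.trans_lt ?_)
      linarith [hm (g^[l] x)]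
    refine ⟨mem_iter_succ_source.2 ⟨h1, hG.strip_subset hstrip⟩, ?_⟩
    obtain ⟨ρ, hρ1, hρ2⟩ := hG.exists_eq_mul hΔ hτ hτ9 (g^[l] x) hstrip
    refine ⟨P * ρ, ?_, ?_⟩
    · rw [iter_succ_apply, Function.iterate_succ_apply', hρ1, h2, hD, iterDeriv_succ]
      push_cast
      ring
    · have hTs : T (l + 1) = T l + τ * (45 / 32 * |m g n (g^[l] x)|) := by
        simp only [hT, Finset.sum_range_succ]
        ring
      have e : P * ρ - 1 = P * (ρ - 1) + (P - 1) := by ring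
      rw [e, hTs, Real.exp_add]
      have h6 : Real.exp (τ * ‖iter G l z - (g^[l] x : ℝ)‖) ≤
          Real.exp (τ * (45 / 32 * |m g n (g^[l] x)|)) :=
        Real.exp_le_exp.2 (mul_le_mul_of_nonneg_left hdist hg.nonneg)
      calc ‖P * (ρ - 1) + (P - 1)‖ ≤ ‖P‖ * ‖ρ - 1‖ + ‖P - 1‖ := by
            rw [← norm_mul]; exact norm_add_le _ _
        _ ≤ Real.exp (T l) * (Real.exp (τ * (45 / 32 * |m g n (g^[l] x)|)) - 1) +
            (Real.exp (T l) - 1) :=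
          add_le_add (mul_le_mul hP (hρ2.trans (by linarith)) (norm_nonneg _)
            (Real.exp_pos _).le) h3
        _ = _ := by ring

/-- The parameter `c` may be `0`, which gives definedness down to the real line; `c = 1/4` gives the
heights in `IsOver`. -/
theorem IsAnalyticDiffeo.iter_estimates (hΔ : 0 < Δ) (hG : IsAnalyticDiffeo Δ g G)
    (hτ : ∀ z ∈ strip Δ, ‖logDeriv (deriv G) z‖ ≤ τ) (hτ9 : τ < 1 / 9)
    (hF : ∀ x, F (g x) = F x + rot g) (hα : Irrational (rot g)) {n : ℕ}
    (hm : ∀ x, |m g n x| < Δ / 2) {z : ℂ} {c : ℝ} (hc : 0 ≤ c) (hzc : c * |m g n z.re| ≤ z.im)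
    (hz : z.im ≤ |m g n z.re|) {l : ℕ} (hl : l ≤ q g (n + 1)) :
    z ∈ (iter G l).source ∧ ‖iter G l z - (g^[l] z.re : ℝ)‖ ≤ 2 * |m g n (g^[l] z.re)| ∧
      2 / 3 * c * |m g n (g^[l] z.re)| ≤ (iter G l z).im := by
  have hg := hG.isSmallDistortion hΔ hτ hτ9
  set D := iterDeriv g (fun x => (deriv G x).re) l z.re with hD
  have hDp : 0 < D := iterDeriv_pos hg l z.re
  have hE := exp_le_of_isSmallDistortion hg
  have hy0 : 0 ≤ z.im := (mul_nonneg hc (abs_nonneg _)).trans hzc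
  have hzx : z - (z.re : ℂ) = z.im * I := by
    apply Complex.ext <;> simp
  have hnorm : ‖z - (z.re : ℂ)‖ = z.im := by
    rw [hzx, norm_mul, norm_I, mul_one, norm_real, Real.norm_of_nonneg hy0]
  obtain ⟨h1, P, h2, h3⟩ := hG.iter_sub_iterate hΔ hτ hτ9 hF hα hm (hnorm.trans_le hz) hl
  obtain ⟨h4, h5⟩ := iterDeriv_mul_abs_m_le hg hF hα hl z.re
  rw [← hD] at h2 h4 h5
  set M := |m g n (g^[l] z.re)|
  have hM : 0 ≤ M := abs_nonneg _
  have hDz : D * z.im ≤ 9 / 8 * M := by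
    calc D * z.im ≤ D * |m g n z.re| := by gcongr
      _ ≤ Real.exp τ * M := h4
      _ ≤ _ := by gcongr
  refine ⟨h1, ?_, ?_⟩
  · have hP : ‖P‖ ≤ 5 / 4 := by
      have := norm_add_le (P - 1) 1
      rw [sub_add_cancel, norm_one] at this
      linarith
    rw [h2, norm_mul, norm_mul, hnorm, norm_real, Real.norm_of_nonneg hDp.le]
    have : 0 ≤ D * z.im := by positivity
    nlinarith [norm_nonneg P]
  · have hre : 3 / 4 ≤ P.re := by
      have := (abs_re_le_norm (P - 1)).trans h3
      rw [sub_re, one_re] at this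
      linarith [(abs_le.1 this).1]
    have him : (iter G l z).im = D * z.im * P.re := by
      have := congrArg im h2
      rw [hzx] at this
      simpa [mul_assoc] using this
    rw [him]
    have h6 : M ≤ 9 / 8 * (D * |m g n z.re|) := h5.trans (by gcongr)
    have h7 : D * (c * |m g n z.re|) ≤ D * z.im := by gcongr
    have h8 : c * M ≤ 9 / 8 * (D * z.im) := by nlinarith
    have h9 : D * z.im * (3 / 4) ≤ D * z.im * P.re := by gcongr
    linarith

end Orbit

/-! ### Partially defined iterates and crossings. -/

section Iterates

variable {G : OpenPartialHomeomorph ℂ ℂ}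

theorem iter_add (a b : ℕ) (z : ℂ) :
    (z ∈ (iter G (a + b)).source ↔ z ∈ (iter G a).source ∧ iter G a z ∈ (iter G b).source) ∧
      iter G (a + b) z = iter G b (iter G a z) := by
  induction b with
  | zero => simp [iter]
  | succ b ih =>
    rw [← add_assoc, mem_iter_succ_source, mem_iter_succ_source, iter_succ_apply, iter_succ_apply,
      ih.1, ih.2, and_assoc]
    exact ⟨Iff.rfl, rfl⟩

theorem isIterate_iff {w₀ w : ℂ} : IsIterate G w₀ w ↔
    (∃ i : ℕ, w₀ ∈ (iter G i).source ∧ iter G i w₀ = w) ∨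
      ∃ i : ℕ, w ∈ (iter G i).source ∧ iter G i w = w₀ := by
  constructor
  · rintro ⟨i | i, h1, rfl⟩
    · exact Or.inl ⟨i, h1, rfl⟩
    · exact Or.inr ⟨i + 1, (iter G (i + 1)).map_target h1, (iter G (i + 1)).right_inv h1⟩
  · rintro (⟨i, h1, h2⟩ | ⟨i, h1, rfl⟩)
    · exact ⟨Int.ofNat i, h1, h2⟩
    · cases i with
      | zero => exact ⟨Int.ofNat 0, mem_univ _, rfl⟩
      | succ i =>
        exact ⟨Int.negSucc i, (iter G (i + 1)).map_source h1, (iter G (i + 1)).left_inv h1⟩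

theorem IsIterate.iter {w₀ w : ℂ} (h : IsIterate G w₀ w) {l : ℕ} (hl : w ∈ (iter G l).source) :
    IsIterate G w₀ (iter G l w) := by
  rw [isIterate_iff] at h ⊢
  rcases h with ⟨i, h1, rfl⟩ | ⟨i, h1, rfl⟩
  · exact Or.inl ⟨i + l, (iter_add i l w₀).1.2 ⟨h1, hl⟩, (iter_add i l w₀).2⟩
  · rcases le_total l i with h | h
    · obtain ⟨k, rfl⟩ := Nat.exists_eq_add_of_le h
      exact Or.inr ⟨k, ((iter_add l k w).1.1 h1).2, (iter_add l k w).2.symm⟩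
    · obtain ⟨k, rfl⟩ := Nat.exists_eq_add_of_le h
      exact Or.inl ⟨k, ((iter_add i k w).1.1 hl).2, (iter_add i k w).2.symm⟩

theorem exists_switch {p : ℕ → Prop} (h0 : ¬ p 0) {i : ℕ} (hi : p i) :
    ∃ s < i, ¬ p s ∧ p (s + 1) := by
  induction i with
  | zero => exact absurd hi h0
  | succ i ih =>
    by_cases h : p i
    · obtain ⟨s, hs, h'⟩ := ih h
      exact ⟨s, by omega, h'⟩
    · exact ⟨i, by omega, h, hi⟩

/-- An orbit that visits `B` but starts outside enters or leaves `B` somewhere. -/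
theorem exists_crossing {B : Set ℂ} {w₀ w : ℂ} (h : IsIterate G w₀ w) (hw : w ∈ B)
    (hw₀ : w₀ ∉ B) : ∃ w', IsIterate G w₀ w' ∧ w' ∈ B ∧
      (G w' ∉ B ∨ ∃ v ∈ G.source, G v = w' ∧ v ∉ B) := by
  rcases isIterate_iff.1 h with ⟨i, h1, rfl⟩ | ⟨i, h1, rfl⟩
  · obtain ⟨s, hs, hs1, hs2⟩ := exists_switch (p := fun s => iter G s w₀ ∈ B) hw₀ hw
    obtain ⟨k, rfl⟩ := Nat.exists_eq_add_of_le (show s + 1 ≤ i from hs)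
    have hsrc := ((iter_add (s + 1) k w₀).1.1 h1).1
    exact ⟨_, isIterate_iff.2 (Or.inl ⟨s + 1, hsrc, rfl⟩), hs2,
      Or.inr ⟨iter G s w₀, (mem_iter_succ_source.1 hsrc).2, rfl, hs1⟩⟩
  · obtain ⟨s, hs, hs1, hs2⟩ := exists_switch (p := fun s => iter G s w ∉ B)
      (not_not.2 (show iter G 0 w ∈ B from hw)) hw₀
    obtain ⟨k, rfl⟩ := Nat.exists_eq_add_of_le (show s + 1 ≤ i from hs)
    have hsrc := ((iter_add (s + 1) k w).1.1 h1).1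
    exact ⟨_, h.iter (mem_iter_succ_source.1 hsrc).1, not_not.1 hs1, Or.inl hs2⟩

end Iterates

/-! ### From real proximity to Poincaré distance. -/

section Position

variable {g F : CircleDeg1Lift} {g' : ℝ → ℝ} {τ : ℝ} {n : ℕ}

/-- `z` lies over the real point `a` at a height comparable with `|m_n(a)|`. -/
def IsOver (g : CircleDeg1Lift) (n : ℕ) (z : ℂ) (a : ℝ) : Prop :=
  ‖z - a‖ ≤ 2 * |m g n a| ∧ 1 / 8 * |m g n a| ≤ z.im

/-- The distance of `a` and `b` is comparable with `|m_n(a)|`, which is comparable with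
`|m_n(b)|`. -/
def IsNear (g : CircleDeg1Lift) (n : ℕ) (a b : ℝ) : Prop :=
  |a - b| ≤ 6 * |m g n a| ∧ |m g n a| ≤ 16 * |m g n b| ∧ |m g n b| ≤ 5 * |m g n a|

theorem IsNear.refl (a : ℝ) : IsNear g n a a := by
  have := abs_nonneg (m g n a)
  refine ⟨?_, ?_, ?_⟩
  · rw [sub_self, abs_zero]; linarith
  all_goals linarith

theorem IsOver.add_int {z : ℂ} {a : ℝ} (h : IsOver g n z a) (k : ℤ) :
    IsOver g n (z + k) (a + k) := by
  obtain ⟨h1, h2⟩ := h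
  refine ⟨?_, ?_⟩
  · rw [m_add_int]
    push_cast
    rwa [add_sub_add_right_eq_sub]
  · rw [m_add_int]
    simpa using h2

theorem IsOver.sub_int {z : ℂ} {a : ℝ} (h : IsOver g n z a) (k : ℤ) :
    IsOver g n (z - k) (a - k) := by
  have := h.add_int (-k)
  push_cast at this
  simpa [sub_eq_add_neg] using this

theorem IsOver.im_le {z : ℂ} {a : ℝ} (h : IsOver g n z a) : z.im ≤ 2 * |m g n a| := by
  have := (abs_im_le_norm (z - a)).trans h.1
  rw [sub_im, ofReal_im, sub_zero] at this
  exact (le_abs_self _).trans this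

theorem distP_comm (z w : ℂ) : distP z w = distP w z := by
  unfold distP
  by_cases h : 0 < z.im ∧ 0 < w.im
  · rw [dif_pos h, dif_pos h.symm, edist_comm]
  · rw [dif_neg h, dif_neg fun h' => h h'.symm]

/-- Origin of `600`: the Euclidean distance is at most `(2 + 6 + 2·5) |m_n(a)|`, the geometric mean
of the heights at least `|m_n(a)|/32`, and `18 · 32 = 576`. -/
theorem distP_lt_of_isNear (hm : ∀ x, 0 < |m g n x|) {z w : ℂ} {a b : ℝ} (hz : IsOver g n z a)
    (hw : IsOver g n w b) (hab : IsNear g n a b) : distP z w < ENNReal.ofReal 600 := by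
  obtain ⟨hz1, hz2⟩ := hz
  obtain ⟨hw1, hw2⟩ := hw
  obtain ⟨h1, h2, h3⟩ := hab
  have ha := hm a
  have hb := hm b
  set ma := |m g n a|
  set mb := |m g n b|
  have hzi : 0 < z.im := by linarith
  have hwi : 0 < w.im := by linarith
  rw [distP, dif_pos ⟨hzi, hwi⟩, edist_dist]
  refine (ENNReal.ofReal_lt_ofReal_iff (by norm_num)).2 ?_
  refine (UpperHalfPlane.dist_le_dist_coe_div_sqrt _ _).trans_lt ?_
  change dist z w / √(z.im * w.im) < 600
  have hsqrt : ma / 32 ≤ √(z.im * w.im) := by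
    refine Real.le_sqrt_of_sq_le ?_
    have h4 : (1 / 8 * ma) * (1 / 8 * mb) ≤ z.im * w.im := by gcongr
    nlinarith
  have hd : dist z w ≤ 18 * ma := by
    rw [dist_eq_norm, show z - w = (z - a) + ((a - b : ℝ) : ℂ) - (w - b) by push_cast; ring]
    refine (norm_sub_le _ _).trans ?_
    have h5 := norm_add_le (z - a) ((a - b : ℝ) : ℂ)
    rw [norm_real, Real.norm_eq_abs] at h5
    linarith
  rw [div_lt_iff₀ (by linarith)]
  linarith

theorem im_le_of_distP_lt {z w : ℂ} {r : ℝ} (h : distP z w < ENNReal.ofReal r) :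
    0 < z.im ∧ z.im ≤ w.im * Real.exp r := by
  by_cases h0 : 0 < z.im ∧ 0 < w.im
  · rw [distP, dif_pos h0, edist_dist] at h
    refine ⟨h0.1, (UpperHalfPlane.im_le_im_mul_exp_dist ⟨z, h0.1⟩ ⟨w, h0.2⟩).trans ?_⟩
    refine mul_le_mul_of_nonneg_left (Real.exp_le_exp.2 ?_) h0.2.le
    exact ((ENNReal.ofReal_lt_ofReal_iff_of_nonneg dist_nonneg).1 h).le
  · rw [distP, dif_neg h0] at h
    exact absurd h (not_lt.2 le_top)

theorem abs_m_bounds (hg : IsSmallDistortion g g' τ) (hF : ∀ x, F (g x) = F x + rot g)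
    (hα : Irrational (rot g)) {a b C : ℝ} (h : |b - a| ≤ C) :
    |m g n a| - 3 / 5 * C ≤ |m g n b| ∧ |m g n b| ≤ |m g n a| + 3 / 5 * C := by
  have h1 := abs_m_sub_le hg hF hα n b a
  have h2 := abs_abs_sub_abs_le_abs_sub (m g n b) (m g n a)
  have h3 := abs_le.1 (h2.trans h1)
  constructor <;> linarith

theorem abs_sub_le_of_mem_uIcc_ret {a u : ℝ} (hu : u ∈ uIcc a (ret g n a)) :
    |u - a| ≤ |m g n a| := by
  rw [← ret_sub_self]
  exact abs_sub_left_of_mem_uIcc hu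

/-- Each of at most three intervals changes `|m_n|` by a factor in `[2/5, 8/5]`; the constants of
`IsNear` absorb `1 + 8/5 + (8/5)²`, `(5/2)³` and `(8/5)³`. -/
theorem exists_isNear (hg : IsSmallDistortion g g' τ) (hF : ∀ x, F (g x) = F x + rot g)
    (hα : Irrational (rot g)) (n : ℕ) (u v : ℝ) :
    ∃ l < q g (n + 1), ∃ k : ℤ, IsNear g n (g^[l] v + k) u := by
  obtain ⟨l, hl, k, hu⟩ := exists_mem_uIcc_ret hF hα n u v
  refine ⟨l, hl, k, ?_⟩
  set a := g^[l] v + k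
  have key : ∀ {a u : ℝ}, u ∈ uIcc a (ret g n a) → |u - a| ≤ |m g n a| ∧
      2 / 5 * |m g n a| ≤ |m g n u| ∧ |m g n u| ≤ 8 / 5 * |m g n a| := by
    intro a u hu
    have h1 := abs_sub_le_of_mem_uIcc_ret hu
    have h2 := abs_m_bounds (n := n) hg hF hα h1
    exact ⟨h1, by linarith, by linarith⟩
  have k1 := key (right_mem_uIcc (a := a) (b := ret g n a))
  have k2 := key (right_mem_uIcc (a := ret g n a) (b := ret g n (ret g n a)))
  have ha := abs_nonneg (m g n a)
  have main : |u - a| ≤ 6 * |m g n a| ∧ |m g n a| ≤ 16 * |m g n u| ∧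
      |m g n u| ≤ 5 * |m g n a| := by
    rcases uIcc_subset_uIcc_union_uIcc (b := ret g n a) hu with h | h
    · have k3 := key h
      exact ⟨by linarith, by linarith, by linarith⟩
    · rcases uIcc_subset_uIcc_union_uIcc (b := ret g n (ret g n a)) h with h | h
      · have k3 := key h
        have := abs_sub_le u (ret g n a) a
        exact ⟨by linarith, by linarith, by linarith⟩
      · have k3 := key h
        have := abs_sub_le u (ret g n a) a
        have := abs_sub_le u (ret g n (ret g n a)) (ret g n a)
        exact ⟨by linarith, by linarith, by linarith⟩
  exact ⟨abs_sub_comm u a ▸ main.1, main.2⟩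

/-- Consecutive errors have opposite signs and decrease in size, so `x` lies in the level-`n`
fundamental interval of its level-`(n + 1)` return. -/
theorem isNear_ret_succ (hg : IsSmallDistortion g g' τ) (hF : ∀ x, F (g x) = F x + rot g)
    (hα : Irrational (rot g)) (n : ℕ) (x : ℝ) : IsNear g n (ret g (n + 1) x) x := by
  set y := ret g (n + 1) x with hy
  have hlt := abs_convErr_succ_lt n hα
  have hneg := convErr_mul_succ_neg hα n
  have hFy : F y = F x + convErr (rot g) (n + 1) := semiconj_ret hF _ _
  have hx : x ∈ uIcc y (ret g n y) := by
    rw [mem_uIcc]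
    rcases lt_or_gt_of_ne (convErr_ne_zero hα n) with h | h
    · have h' : 0 < convErr (rot g) (n + 1) := by
        by_contra! h0
        nlinarith
      rw [abs_of_neg h, abs_of_pos h'] at hlt
      right
      constructor <;> refine (lt_of_semiconj_lt (F := F) ?_).le
      · rw [semiconj_ret hF, hFy]; linarith
      · rw [hFy]; linarith
    · have h' : convErr (rot g) (n + 1) < 0 := by
        by_contra! h0
        nlinarith
      rw [abs_of_pos h, abs_of_neg h'] at hlt
      left
      constructor <;> refine (lt_of_semiconj_lt (F := F) ?_).le
      · rw [hFy]; linarith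
      · rw [semiconj_ret hF, hFy]; linarith
  have h1 := abs_sub_le_of_mem_uIcc_ret hx
  have h2 := abs_m_bounds (n := n) hg hF hα h1
  have h3 := abs_nonneg (m g n y)
  exact ⟨by rw [abs_sub_comm]; linarith, by linarith, by linarith⟩

end Position

/-! ### Orbits cannot jump across the layer under the curve. -/

section Crossing

variable {Δ τ : ℝ} {g F : CircleDeg1Lift} {G : OpenPartialHomeomorph ℂ ℂ} {n : ℕ}

/-- The open region below the graph of `3/4 |m_n|`. -/
def below (g : CircleDeg1Lift) (n : ℕ) : Set ℂ := {z | 0 < z.im ∧ z.im < 3 / 4 * |m g n z.re|}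

theorem sub_ofReal_re (z : ℂ) : z - (z.re : ℂ) = z.im * I := by
  apply Complex.ext <;> simp

theorem deriv_mul_abs_m_le (hg : IsSmallDistortion g (fun x => (deriv G x).re) τ)
    (hF : ∀ x, F (g x) = F x + rot g) (hα : Irrational (rot g)) (x : ℝ) :
    (deriv G x).re * |m g n x| ≤ 9 / 8 * |m g n (g x)| ∧
      |m g n (g x)| ≤ 9 / 8 * ((deriv G x).re * |m g n x|) := by
  obtain ⟨h1, h2⟩ := iterDeriv_mul_abs_m_le (n := n) (l := 1) hg hF hα
    (Real.convergent (rot g) (n + 1)).den_pos x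
  simp only [iterDeriv, Finset.prod_range_one, Function.iterate_zero, id, Function.iterate_one]
    at h1 h2
  have hE := exp_le_of_isSmallDistortion hg
  have h3 := (hg.pos x).le
  constructor
  · exact h1.trans (by gcongr)
  · exact h2.trans (by gcongr)

theorem exp_mul_le_of_le {r : ℝ} (hτ9 : τ < 1 / 9) (hr0 : 0 ≤ r) (hr : r ≤ 1 / 2) :
    Real.exp (τ * r) ≤ 11 / 10 := by
  have h : τ * r ≤ 1 / 18 := by nlinarith
  refine (Real.exp_le_exp.2 h).trans ((exp_le_inv_one_sub (by norm_num)).trans ?_)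
  norm_num

/-- Below `1/4 |m_n|`, one step scales height and `|m_n|` by almost the same factor and shifts the
real part little, so the image is still under `3/4 |m_n|`. -/
theorem IsAnalyticDiffeo.height_of_leaving (hΔ : 0 < Δ) (hG : IsAnalyticDiffeo Δ g G)
    (hτ : ∀ z ∈ strip Δ, ‖logDeriv (deriv G) z‖ ≤ τ) (hτ9 : τ < 1 / 9)
    (hF : ∀ x, F (g x) = F x + rot g) (hα : Irrational (rot g))
    (hm : ∀ x, |m g n x| < Δ / 2) (hm' : ∀ x, |m g n x| < 1 / 2) {w : ℂ} (hw : w ∈ below g n)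
    (hGw : G w ∉ below g n) : 1 / 4 * |m g n w.re| ≤ w.im := by
  have hg := hG.isSmallDistortion hΔ hτ hτ9
  by_contra! hlt
  obtain ⟨hy, hy'⟩ := hw
  set x := w.re with hx
  set y := w.im with hyd
  set d := (deriv G x).re with hd
  have hdpos : 0 < d := hg.pos x
  have hwx := sub_ofReal_re w
  have hnorm : ‖w - (x : ℂ)‖ = y := by
    rw [hwx, norm_mul, norm_I, mul_one, norm_real, Real.norm_of_nonneg hy.le]
  have hstrip : w ∈ strip Δ := mem_strip_of_norm_lt (x := x) (by rw [hnorm]; linarith [hm x])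
  obtain ⟨ρ, h1, h2⟩ := hG.exists_eq_mul hΔ hτ hτ9 x hstrip
  rw [hnorm] at h2
  have h3 := exp_mul_le_of_le hτ9 hy.le (by linarith [hm' x])
  have hρ : ‖ρ - 1‖ ≤ 1 / 10 := by linarith
  have hρre := abs_le.1 ((abs_re_le_norm _).trans hρ)
  have hρim := abs_le.1 ((abs_im_le_norm _).trans hρ)
  simp only [sub_re, one_re, sub_im, one_im, sub_zero] at hρre hρim
  rw [hwx, ← hd] at h1
  have him : (G w).im = d * y * ρ.re := by
    have := congrArg im h1
    simpa [mul_assoc] using this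
  have hre : (G w).re - g x = -(d * y * ρ.im) := by
    have := congrArg re h1
    simpa [mul_assoc] using this
  have hdy : 0 < d * y := mul_pos hdpos hy
  have hpos : 0 < (G w).im := by
    rw [him]; exact mul_pos hdy (by linarith)
  have hge : 3 / 4 * |m g n (G w).re| ≤ (G w).im := by
    by_contra! h
    exact hGw ⟨hpos, h⟩
  have hdist : |(G w).re - g x| ≤ 1 / 10 * (d * y) := by
    rw [hre, abs_le]
    constructor <;> nlinarith
  have h4 := (abs_m_bounds (n := n) hg hF hα hdist).1
  have h5 := (deriv_mul_abs_m_le (n := n) hg hF hα x).1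
  have h6 : d * y ≤ 1 / 4 * (d * |m g n x|) := by
    calc d * y ≤ d * (1 / 4 * |m g n x|) := by gcongr
      _ = _ := by ring
  have h7 : (G w).im ≤ 11 / 10 * (d * y) := by rw [him]; nlinarith
  rw [← hd] at h5
  linarith

theorem IsAnalyticDiffeo.height_of_entering (hΔ : 0 < Δ) (hG : IsAnalyticDiffeo Δ g G)
    (hτ : ∀ z ∈ strip Δ, ‖logDeriv (deriv G) z‖ ≤ τ) (hτ9 : τ < 1 / 9)
    (hF : ∀ x, F (g x) = F x + rot g) (hα : Irrational (rot g))
    (hm : ∀ x, |m g n x| < Δ / 2) (hm' : ∀ x, |m g n x| < 1 / 2) {v : ℂ} (hv : v ∈ G.source)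
    (hw : G v ∈ below g n) (hvB : v ∉ below g n) :
    1 / 4 * |m g n (G v).re| ≤ (G v).im := by
  have hg := hG.isSmallDistortion hΔ hτ hτ9
  by_contra! hlt
  obtain ⟨hy, hy'⟩ := hw
  obtain ⟨x, hgx⟩ := (bijective_of_isSmallDistortion hg).2 (G v).re
  rw [← hgx] at hlt hy'
  set y := (G v).im with hyd
  set d := (deriv G x).re with hd
  have hdpos : 0 < d := hg.pos x
  obtain ⟨h5, h6⟩ := deriv_mul_abs_m_le (n := n) hg hF hα x
  rw [← hd] at h5 h6
  have hwx : G v - (g x : ℂ) = y * I := by rw [hgx]; exact sub_ofReal_re (G v)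
  have hnorm : ‖G v - (g x : ℂ)‖ = y := by
    rw [hwx, norm_mul, norm_I, mul_one, norm_real, Real.norm_of_nonneg hy.le]
  have hr : 3 * y / d ≤ |m g n x| := by
    rw [div_le_iff₀ hdpos]; linarith
  have hr0 : 0 < 3 * y / d := by positivity
  -- A priori `v` may lie anywhere in the source, outside the strip. A preimage is found near `x`,
  -- and injectivity of `G` identifies it with `v`. The radius `3y/d` makes the covered disc `27/20
  -- y > y`.
  obtain ⟨z, hz1, hz2⟩ := hG.exists_preimage hΔ hτ hτ9 x hr0 (by linarith [hm x])
    (exp_mul_le_of_le hτ9 hr0.le (by linarith [hm' x])) (w := G v) (by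
      rw [hnorm, ← hd, show 9 / 20 * d * (3 * y / d) = 27 / 20 * y by field_simp; ring]
      linarith)
  have hzs : z ∈ strip Δ := mem_strip_of_norm_lt (hz1.trans_lt (by linarith [hm x]))
  obtain rfl : z = v := G.injOn (hG.strip_subset hzs) hv hz2
  obtain ⟨ρ, h1, h2⟩ := hG.exists_eq_mul hΔ hτ hτ9 x hzs
  have h3 := exp_mul_le_of_le hτ9 (norm_nonneg (z - x)) (by linarith [hm' x])
  have hρ : ‖1 - ρ‖ ≤ 1 / 10 := by rw [norm_sub_rev]; linarith
  rw [hwx, ← hd] at h1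
  set ζ : ℂ := d * (z - x) with hζ
  have e1 : ζ - y * I = ζ * (1 - ρ) := by rw [h1]; ring
  have hζn : ‖ζ - y * I‖ ≤ 1 / 9 * y := by
    have h8 : ‖ζ - y * I‖ ≤ ‖ζ‖ * (1 / 10) := by
      rw [e1, norm_mul]; gcongr
    have h9 : ‖ζ‖ ≤ ‖ζ - y * I‖ + y := by
      have := norm_add_le (ζ - y * I) (y * I)
      rwa [sub_add_cancel, norm_mul (y : ℂ), norm_I, mul_one, norm_real,
        Real.norm_of_nonneg hy.le] at this
    linarith
  have hre := (abs_re_le_norm _).trans hζn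
  have him := abs_le.1 ((abs_im_le_norm _).trans hζn)
  have ere : (ζ - y * I).re = d * (z.re - x) := by simp [hζ]
  have eim : (ζ - y * I).im = d * z.im - y := by simp [hζ]
  rw [ere, abs_mul, abs_of_pos hdpos] at hre
  rw [eim] at him
  have hpos : 0 < z.im := by
    have : 0 < d * z.im := by linarith
    exact pos_of_mul_pos_right this hdpos.le
  have hge : 3 / 4 * |m g n z.re| ≤ z.im := by
    by_contra! h
    exact hvB ⟨hpos, h⟩
  have h4 := (abs_m_bounds (n := n) hg hF hα (le_refl |z.re - x|)).1
  have h10 : d * (3 / 4 * (|m g n x| - 3 / 5 * |z.re - x|)) ≤ d * z.im := by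
    gcongr
    linarith
  linarith

end Crossing

/-! ### The curve `3/4 |m_n|` and the three conclusions. -/

section Curve

variable {Δ τ : ℝ} {g F : CircleDeg1Lift} {G : OpenPartialHomeomorph ℂ ℂ} {n : ℕ}

/-- The graph of `3/4 |m_n|`. -/
def curve (g : CircleDeg1Lift) (n : ℕ) : Set ℂ := {z | z.im = 3 / 4 * |m g n z.re|}

/-- The point of `curve g n` over `x`. -/
noncomputable def curvePoint (g : CircleDeg1Lift) (n : ℕ) (x : ℝ) : ℂ := ⟨x, 3 / 4 * |m g n x|⟩

theorem curvePoint_mem (x : ℝ) : curvePoint g n x ∈ curve g n := rfl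

/-- Since `α ≠ 0`, the real flow reaches every point from `x`, and the flow line keeps the
coordinate `3/4`. -/
theorem flowLine_eq_curve (hα : Irrational (rot g)) (h : ℝ ≃ₜ ℝ) {x : ℝ} (hx : 0 < |m g n x|) :
    flowLine g h n (curvePoint g n x) = curve g n := by
  have hy : ycoord g n (curvePoint g n x) = 3 / 4 := by
    rw [ycoord, curvePoint, mul_div_assoc, div_self hx.ne', mul_one]
  ext z
  constructor
  · rintro ⟨t, rfl⟩
    simp only [flowC, hy, curve, mem_ofPred_eq]
    ring
  · intro hz
    refine ⟨(h.symm z.re - h.symm x) / rot g, ?_⟩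
    have : flow g h ((h.symm z.re - h.symm x) / rot g) x = z.re := by
      rw [flow, div_mul_cancel₀ _ hα.ne_zero, add_sub_cancel, h.apply_symm_apply]
    apply Complex.ext
    · exact this
    · change |m g n (flow g h ((h.symm z.re - h.symm x) / rot g) x)| * ycoord g n _ = z.im
      rw [this, hy, show z.im = _ from hz]
      ring

theorem between_curve : between (curve g n) = below g n := by
  ext z
  constructor
  · rintro ⟨h0, w, hw, hwz, hlt⟩
    refine ⟨h0, ?_⟩
    rwa [show w.im = _ from hw, hwz] at hlt
  · rintro ⟨h0, hlt⟩
    exact ⟨h0, curvePoint g n z.re, rfl, rfl, hlt⟩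

theorem IsAnalyticDiffeo.isOver_iter (hΔ : 0 < Δ) (hG : IsAnalyticDiffeo Δ g G)
    (hτ : ∀ z ∈ strip Δ, ‖logDeriv (deriv G) z‖ ≤ τ) (hτ9 : τ < 1 / 9)
    (hF : ∀ x, F (g x) = F x + rot g) (hα : Irrational (rot g))
    (hm : ∀ x, |m g n x| < Δ / 2) {z : ℂ} (hz : 1 / 4 * |m g n z.re| ≤ z.im)
    (hz' : z.im ≤ |m g n z.re|) {l : ℕ} (hl : l ≤ q g (n + 1)) :
    z ∈ (iter G l).source ∧ IsOver g n (iter G l z) (g^[l] z.re) := by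
  obtain ⟨h1, h2, h3⟩ := hG.iter_estimates hΔ hτ hτ9 hF hα hm (by norm_num) hz hz' hl
  refine ⟨h1, h2, ?_⟩
  linarith [abs_nonneg (m g n (g^[l] z.re))]

theorem isOver_of_mem_curve {z : ℂ} (hz : z ∈ curve g n) : IsOver g n z z.re := by
  have hz' : z.im = 3 / 4 * |m g n z.re| := hz
  have h0 := abs_nonneg (m g n z.re)
  have hn : ‖z - (z.re : ℂ)‖ = z.im := by
    rw [sub_ofReal_re, norm_mul, norm_I, mul_one, norm_real, Real.norm_of_nonneg (by linarith)]
  exact ⟨by rw [hn]; linarith, by linarith⟩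

theorem IsAnalyticDiffeo.isOver_iter_of_mem_curve (hΔ : 0 < Δ) (hG : IsAnalyticDiffeo Δ g G)
    (hτ : ∀ z ∈ strip Δ, ‖logDeriv (deriv G) z‖ ≤ τ) (hτ9 : τ < 1 / 9)
    (hF : ∀ x, F (g x) = F x + rot g) (hα : Irrational (rot g))
    (hm : ∀ x, |m g n x| < Δ / 2) {z : ℂ} (hz : z ∈ curve g n) {l : ℕ} (hl : l ≤ q g (n + 1)) :
    z ∈ (iter G l).source ∧ IsOver g n (iter G l z) (g^[l] z.re) := by
  have hz' : z.im = 3 / 4 * |m g n z.re| := hz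
  have h0 := abs_nonneg (m g n z.re)
  exact hG.isOver_iter hΔ hτ hτ9 hF hα hm (by linarith) (by linarith) hl

theorem continuous_m (hg : Continuous g) (n : ℕ) : Continuous (m g n) :=
  ((hg.iterate _).sub continuous_id).sub continuous_const

theorem IsAnalyticDiffeo.isQuasiInvariant_curve (hΔ : 0 < Δ) (hG : IsAnalyticDiffeo Δ g G)
    (hτ : ∀ z ∈ strip Δ, ‖logDeriv (deriv G) z‖ ≤ τ) (hτ9 : τ < 1 / 9)
    (hF : ∀ x, F (g x) = F x + rot g) (hα : Irrational (rot g))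
    (hm : ∀ x, |m g n x| < Δ / 2) :
    IsQuasiInvariant g G (n + 1) 600 (curve g n) := by
  have hg := hG.isSmallDistortion hΔ hτ hτ9
  have hbij := bijective_of_isSmallDistortion hg
  have hpos := abs_m_pos hF hα n
  refine ⟨⟨fun x => 3 / 4 * |m g n x|, ?_, fun x => ?_, fun x => ?_, rfl⟩, fun j hj z hz => ?_,
    fun j hj => ?_, fun z hz => ?_⟩
  · exact continuous_const.mul
      (continuous_m (g.continuous_iff_surjective.2 hbij.2) n).abs
  · have := hpos x
    positivity
  · have := m_add_int (g := g) n x 1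
    rw [Int.cast_one] at this
    simp only [this]
  · obtain ⟨h0, w, hw, hwz, hle⟩ := hz
    rw [show w.im = _ from hw, hwz] at hle
    exact (hG.iter_estimates hΔ hτ hτ9 hF hα hm (c := 0) le_rfl (by simpa using h0)
      (by linarith [hpos z.re]) hj).1
  · refine sup_le (iSup₂_le ?_) (iSup₂_le ?_)
    · rintro _ ⟨z, hz, rfl⟩
      refine iInf₂_le_of_le (curvePoint g n (g^[j] z.re)) (curvePoint_mem _) ?_
      exact (distP_lt_of_isNear hpos
        (hG.isOver_iter_of_mem_curve hΔ hτ hτ9 hF hα hm hz hj).2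
        (isOver_of_mem_curve (curvePoint_mem _)) (IsNear.refl _)).le
    · intro b hb
      obtain ⟨x, hx⟩ := (hbij.2.iterate j) b.re
      refine iInf₂_le_of_le _ (mem_image_of_mem _ (curvePoint_mem x)) ?_
      refine (distP_lt_of_isNear hpos
        (hG.isOver_iter_of_mem_curve hΔ hτ hτ9 hF hα hm (curvePoint_mem x) hj).2
        (isOver_of_mem_curve hb) ?_).le
      change IsNear g n (g^[j] x) b.re
      rw [hx]
      exact IsNear.refl _
  · exact (distP_lt_of_isNear hpos
      ((hG.isOver_iter_of_mem_curve hΔ hτ hτ9 hF hα hm hz le_rfl).2.sub_int (p g (n + 1)))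
      (isOver_of_mem_curve hz) (isNear_ret_succ hg hF hα n z.re)).le

theorem IsAnalyticDiffeo.separates (hΔ : 0 < Δ) (hG : IsAnalyticDiffeo Δ g G)
    (hτ : ∀ z ∈ strip Δ, ‖logDeriv (deriv G) z‖ ≤ τ) (hτ9 : τ < 1 / 9)
    (hF : ∀ x, F (g x) = F x + rot g) (hα : Irrational (rot g))
    (hm : ∀ x, |m g n x| < Δ / 2) {H : ℝ} (hmH : ∀ x, |m g n x| < H / (2 * Real.exp 600)) {z₀ : ℂ}
    (hz₀ : z₀ ∈ curve g n) :
    Separates (⋃ j ∈ Iio (q g (n + 1)), ballsMod (iter G j z₀) 600)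
      (range ((↑) : ℝ → ℂ)) {z : ℂ | H < z.im} := by
  have hg := hG.isSmallDistortion hΔ hτ hτ9
  have hpos := abs_m_pos hF hα n
  have hover : ∀ j ≤ q g (n + 1), IsOver g n (iter G j z₀) (g^[j] z₀.re) := fun j hj =>
    (hG.isOver_iter_of_mem_curve hΔ hτ hτ9 hF hα hm hz₀ hj).2
  have hE := Real.exp_pos 600
  have hmH' : ∀ x, |m g n x| * (2 * Real.exp 600) < H := fun x =>
    (lt_div_iff₀ (by positivity)).1 (hmH x)
  set U := ⋃ j ∈ Iio (q g (n + 1)), ballsMod (iter G j z₀) 600 with hU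
  have hUmem : ∀ z ∈ U, 0 < z.im ∧ z.im ≤ H := by
    intro z hz
    simp only [hU, ballsMod, mem_iUnion] at hz
    obtain ⟨j, hj, k, hz⟩ := hz
    obtain ⟨h1, h2⟩ := im_le_of_distP_lt hz
    refine ⟨h1, h2.trans ?_⟩
    have h3 := ((hover j (le_of_lt hj)).add_int k).im_le
    have h4 := hmH' (g^[j] z₀.re + k)
    nlinarith
  have hcurve : curve g n ⊆ U := by
    intro z hz
    obtain ⟨l, hl, k, hnear⟩ := exists_isNear hg hF hα n z.re z₀.re
    simp only [hU, ballsMod, mem_iUnion]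
    refine ⟨l, hl, k, ?_⟩
    change distP _ _ < _
    rw [distP_comm]
    exact distP_lt_of_isNear hpos ((hover l (le_of_lt hl)).add_int k) (isOver_of_mem_curve hz) hnear
  have hd1 : Disjoint U (range ((↑) : ℝ → ℂ)) := by
    rw [Set.disjoint_left]
    rintro _ hz ⟨x, rfl⟩
    simpa using (hUmem _ hz).1
  refine ⟨hd1, ?_, ?_⟩
  · rw [Set.disjoint_left]
    intro z hz hz'
    exact absurd (hUmem z hz).2 (not_le.2 hz')
  · rintro _ ⟨x, rfl⟩ b hb hbc
    have hx : (x : ℂ) ∈ Uᶜ := fun h => Set.disjoint_left.1 hd1 h ⟨x, rfl⟩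
    have hcont : Continuous fun z : ℂ => z.im - 3 / 4 * |m g n z.re| := by
      have := continuous_m (g.continuous_iff_surjective.2 (bijective_of_isSmallDistortion hg).2) n
      fun_prop
    -- A component meeting both sets would contain a zero of `Im z - 3/4 |m_n(Re z)|`, a point of
    -- the curve, and the balls cover the curve.
    have hI := isPreconnected_connectedComponentIn.intermediate_value
      (mem_connectedComponentIn hx) hbc hcont.continuousOn
    obtain ⟨z, hz, hz0⟩ := hI (show (0 : ℝ) ∈ _ by
      have h1 := hpos x
      have h2 := hmH' b.re
      have h3 : 1 ≤ Real.exp 600 := Real.one_le_exp (by norm_num)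
      have h4 : H < b.im := hb
      have h5 := hpos b.re
      constructor
      · simp only [ofReal_im, ofReal_re]; linarith
      · nlinarith)
    exact connectedComponentIn_subset _ _ hz (hcurve (sub_eq_zero.1 hz0))

theorem IsAnalyticDiffeo.exists_isIterate_mem_ballsMod (hΔ : 0 < Δ) (hG : IsAnalyticDiffeo Δ g G)
    (hτ : ∀ z ∈ strip Δ, ‖logDeriv (deriv G) z‖ ≤ τ) (hτ9 : τ < 1 / 9)
    (hF : ∀ x, F (g x) = F x + rot g) (hα : Irrational (rot g))
    (hm : ∀ x, |m g n x| < Δ / 2) (hm' : ∀ x, |m g n x| < 1 / 2) {z₀ w₀ w : ℂ}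
    (hz₀ : z₀ ∈ curve g n) (hw₀ : w₀ ∉ below g n) (hit : IsIterate G w₀ w) (hw : w ∈ below g n)
    {j : ℕ} (hj : j ≤ q g (n + 1)) :
    ∃ w, IsIterate G w₀ w ∧ w ∈ ballsMod (iter G j z₀) 600 := by
  have hg := hG.isSmallDistortion hΔ hτ hτ9
  obtain ⟨u, hu1, hu2, hu3⟩ := exists_crossing hit hw hw₀
  have hlow : 1 / 4 * |m g n u.re| ≤ u.im := by
    rcases hu3 with h | ⟨v, hv, rfl, hvB⟩
    · exact hG.height_of_leaving hΔ hτ hτ9 hF hα hm hm' hu2 h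
    · exact hG.height_of_entering hΔ hτ hτ9 hF hα hm hm' hv hu2 hvB
  have hhigh : u.im ≤ |m g n u.re| := by linarith [hu2.2, abs_nonneg (m g n u.re)]
  obtain ⟨l, hl, k, hnear⟩ := exists_isNear hg hF hα n (g^[j] z₀.re) u.re
  obtain ⟨h1, h2⟩ := hG.isOver_iter hΔ hτ hτ9 hF hα hm hlow hhigh hl.le
  refine ⟨iter G l u, hu1.iter h1, mem_iUnion.2 ⟨-k, ?_⟩⟩
  have h3 := (hG.isOver_iter_of_mem_curve hΔ hτ hτ9 hF hα hm hz₀ hj).2.add_int (-k)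
  refine distP_lt_of_isNear (abs_m_pos hF hα n) h2 h3 ?_
  obtain ⟨n1, n2, n3⟩ := hnear
  rw [m_add_int] at n1 n2 n3
  refine ⟨?_, ?_, ?_⟩
  · refine (congrArg _ ?_).trans_le n1
    push_cast
    ring
  · rwa [m_add_int]
  · rwa [m_add_int]

end Curve

end CircleDyn

theorem mainTheorem5 :
    ∃ C₀ : ℝ, 0 < C₀ ∧
      ∀ (Δ : ℝ) (g : CircleDeg1Lift) (G : OpenPartialHomeomorph ℂ ℂ),
        0 < Δ → CircleDyn.IsAnalyticDiffeo Δ g G → Irrational (CircleDyn.rot g) →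
        (∃ τ : ℝ, τ < 1 / 9 ∧ ∀ z ∈ CircleDyn.strip Δ, ‖logDeriv (deriv G) z‖ ≤ τ) →
        ∃ h : ℝ ≃ₜ ℝ, CircleDyn.IsLinearization g h ∧
          ∀ H : ℝ, 0 < H → ∃ n₀ : ℕ, 1 ≤ n₀ ∧ ∀ n : ℕ, n₀ ≤ n →
            ∃ z₀ : ℂ, CircleDyn.ycoord g (n - 1) z₀ ∈ Set.Ioo (1 / 2 : ℝ) 1 ∧
              CircleDyn.IsQuasiInvariant g G n C₀ (CircleDyn.flowLine g h (n - 1) z₀) ∧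
              (∀ j ≤ CircleDyn.q g n, z₀ ∈ (CircleDyn.iter G j).source) ∧
              CircleDyn.Separates
                (⋃ j ∈ Set.Iio (CircleDyn.q g n),
                  CircleDyn.ballsMod (CircleDyn.iter G j z₀) C₀)
                (Set.range ((↑) : ℝ → ℂ)) {z : ℂ | H < z.im} ∧
              ∀ w₀ : ℂ, H < w₀.im →
                (∃ w, CircleDyn.IsIterate G w₀ w ∧
                  w ∈ CircleDyn.between (CircleDyn.flowLine g h (n - 1) z₀)) →
                ∀ j ≤ CircleDyn.q g n, ∃ w, CircleDyn.IsIterate G w₀ w ∧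
                  w ∈ CircleDyn.ballsMod (CircleDyn.iter G j z₀) C₀ := by
  refine ⟨600, by norm_num, ?_⟩
  rintro Δ g G hΔ hG hα ⟨τ, hτ9, hτ⟩
  have hg := hG.isSmallDistortion hΔ hτ hτ9
  obtain ⟨h, hh⟩ := CircleDyn.exists_isLinearization hg hα
  refine ⟨h, hh, fun H hH => ?_⟩
  obtain ⟨F, -, hF⟩ := hh.exists_semiconj
  -- The three thresholds keep shadowing orbits in the strip, make the one-step factor at most
  -- `11/10`, and keep the balls, whose heights are at most `2 |m_n| e^600`, under `H`.
  have hε : 0 < min (Δ / 2) (min (1 / 2) (H / (2 * Real.exp 600))) := by positivity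
  obtain ⟨n₀, hn₀⟩ := CircleDyn.eventually_abs_m_lt hα hh hε
  refine ⟨n₀ + 1, by omega, fun n hn => ?_⟩
  obtain ⟨N, rfl⟩ : ∃ N, n = N + 1 := ⟨n - 1, by omega⟩
  rw [Nat.add_sub_cancel]
  have hm0 := hn₀ N (by omega)
  have hm : ∀ x, |CircleDyn.m g N x| < Δ / 2 := fun x => (hm0 x).trans_le (min_le_left _ _)
  have hm' : ∀ x, |CircleDyn.m g N x| < 1 / 2 := fun x =>
    (hm0 x).trans_le ((min_le_right _ _).trans (min_le_left _ _))
  have hmH : ∀ x, |CircleDyn.m g N x| < H / (2 * Real.exp 600) := fun x =>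
    (hm0 x).trans_le ((min_le_right _ _).trans (min_le_right _ _))
  have hpos := CircleDyn.abs_m_pos hF hα N 0
  have hz₀ := CircleDyn.curvePoint_mem (g := g) (n := N) 0
  refine ⟨CircleDyn.curvePoint g N 0, ?_, ?_, fun j hj => ?_, ?_, ?_⟩
  · rw [CircleDyn.ycoord, CircleDyn.curvePoint, mul_div_assoc, div_self hpos.ne']
    norm_num
  · rw [CircleDyn.flowLine_eq_curve hα h hpos]
    exact hG.isQuasiInvariant_curve hΔ hτ hτ9 hF hα hm
  · exact (hG.isOver_iter_of_mem_curve hΔ hτ hτ9 hF hα hm hz₀ hj).1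
  · exact hG.separates hΔ hτ hτ9 hF hα hm hmH hz₀
  · rintro w₀ hw₀ ⟨w, hit, hw⟩ j hj
    rw [CircleDyn.flowLine_eq_curve hα h hpos, CircleDyn.between_curve] at hw
    refine hG.exists_isIterate_mem_ballsMod hΔ hτ hτ9 hF hα hm hm' hz₀ (fun hB => ?_) hit hw hj
    have h1 := hmH w₀.re
    rw [lt_div_iff₀ (by positivity)] at h1
    have h2 : 1 ≤ Real.exp 600 := Real.one_le_exp (by norm_num)
    nlinarith [hB.2, abs_nonneg (CircleDyn.m g N w₀.re)]
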